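/- For a unitary $N\times N$ matrix $U$ with eigenvalues $e^{i\theta_1},\dots,e^{i\theta_N}$ (counted with multiplicity), let $$Z(\theta)=Z_U(\theta)=\det\left(I-Ue^{-i\theta}\right)=\prod_{m=1}^{N}\left(1-e^{i\theta_m}e^{-i\theta}\right)\qquad(\theta\in\mathbb{R}),$$ let $Z^{(n)}$ denote the $n$th derivative of $Z$ with respect to $\theta$, and let $\mathbb{E}_N$ denote the expectation when $U$ is distributed according to Haar probability measure on the group of $N\times N$ unitary matrices. Then for all fixed positive integers $n_1,\dots,n_k$, $$\mathbb{E}_N\left[\frac1N\sum_{m=1}^{N}Z^{(n_1)}(\theta_m)\cdots Z^{(n_k)}(\theta_m)\right]\sim(-1)^{n_1+\dots+n_k-k}\,i^{\,n_1+\dots+n_k}\,\frac{n_1!\cdots n_k!}{(n_1+\dots+n_k+1)!}\,N^{n_1+\dots+n_k}$$ as $N\to\infty$. -/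

import Mathlib

open MeasureTheory Asymptotics Filter

namespace RandomUnitary

/-- The Borel sigma-algebra on the group `U(N)` of unitary `N × N` complex matrices. -/
noncomputable instance instMeasurableSpace (N : ℕ) : MeasurableSpace (Matrix.unitaryGroup (Fin N) ℂ) :=
  borel _

instance instBorelSpace (N : ℕ) : BorelSpace (Matrix.unitaryGroup (Fin N) ℂ) := ⟨rfl⟩

instance instCompactSpace (N : ℕ) : CompactSpace (Matrix.unitaryGroup (Fin N) ℂ) := by
  rw [← isCompact_univ_iff, Subtype.isCompact_iff, Set.image_univ, Subtype.range_coe]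
  have hK : IsCompact (Set.univ.pi fun _ : Fin N => Set.univ.pi fun _ : Fin N =>
      Metric.closedBall (0 : ℂ) 1) :=
    isCompact_univ_pi fun _ => isCompact_univ_pi fun _ => isCompact_closedBall 0 1
  refine IsCompact.of_isClosed_subset hK
    (isClosed_unitary (R := Matrix (Fin N) (Fin N) ℂ)) ?_
  intro U hU i _ j _
  simpa using entry_norm_bound_of_unitary hU i j

/-- The Haar probability measure on `U(N)` (normalized so that the whole group has mass `1`). -/
noncomputable def haar (N : ℕ) : Measure (Matrix.unitaryGroup (Fin N) ℂ) :=
  Measure.haarMeasure ⊤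

/-- The expectation `𝔼_N[X]` of a complex random variable over Haar measure on `U(N)`. -/
noncomputable def expectation (N : ℕ) (X : Matrix.unitaryGroup (Fin N) ℂ → ℂ) : ℂ :=
  ∫ U, X U ∂(haar N)

/-- The characteristic polynomial `Z_U(θ) = det (I - U e^{-iθ}) = ∏ₘ (1 - e^{iθₘ} e^{-iθ})`,
as a function of the real variable `θ`, where the `e^{iθₘ}` are the eigenvalues of `U`. -/
noncomputable def Z {N : ℕ} (U : Matrix.unitaryGroup (Fin N) ℂ) (θ : ℝ) : ℂ :=
  (1 - Complex.exp (-(Complex.I * θ)) • (U : Matrix (Fin N) (Fin N) ℂ)).det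

/-- The eigenangles `θ₁, …, θ_N` of `U`: the arguments, in `(-π, π]`, of the eigenvalues
`e^{iθ₁}, …, e^{iθ_N}` of `U`, counted with algebraic multiplicity. -/
noncomputable def eigenangles {N : ℕ} (U : Matrix.unitaryGroup (Fin N) ℂ) : Multiset ℝ :=
  (U : Matrix (Fin N) (Fin N) ℂ).charpoly.roots.map Complex.arg

/-- The average `(1/N) ∑ₘ Z^{(n₁)}(θₘ) ⋯ Z^{(n_k)}(θₘ)` over the eigenangles of `U`. -/
noncomputable def mixedDerivAverage {k : ℕ} (n : Fin k → ℕ) {N : ℕ}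
    (U : Matrix.unitaryGroup (Fin N) ℂ) : ℂ :=
  (1 / (N : ℂ)) *
    ((eigenangles U).map fun θ => ∏ j, iteratedDeriv (n j) (Z U) θ).sum

end RandomUnitary

/-! Write `e_r`, `h_a`, `p_R` for the elementary, complete and power-sum symmetric functions of the
eigenvalues. Since `Z(θ) = Σ_r (-1)^r e_r e^{-irθ}`, and at an eigenangle the exponential is a power
of the conjugate eigenvalue, the average over eigenangles is a finite combination of `conj p_R · ∏
e_{r_j}` with `R = Σ r_j`. Everything rests on the exact Haar mean of these products for `N ≥ 2`
(`integral_conj_eigenPowerSum_mul_prod_minorSum`); the rest is summation.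

For the mean, expand `p_R = Σ_c (-1)^(c+1) c e_c h_{R-c}`. As the eigenvalues have modulus one,
`conj e_c = conj det · e_{N-c}`. Up to a binomial constant `h_a` is the average of `U₀₀ ^ a` over
the conjugacy class, so against class functions it may be traded for `U₀₀ ^ a`. What remains is the
pairing of a product of `e`'s, read as sums of principal minors, with `U₀₀ ^ a * det U`. Invariance
under diagonal phases and permutation matrices kills most monomials and leaves, up to sign, two
values, found by pairing with the full determinant and with one cofactor. Counting then gives a
single binomial coefficient (`cornerPairing_prod_minorSum`).

In the summation, with `k` factors, the binomial weights produce a `k`-th difference of `M ↦ Σ_{Σ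
r_j = M} ∏ r_j ^ n_j`, and Abel summation in `c` absorbs the factor `c` and one difference
(`sum_expectation_eq`). In the binomial basis, convolution raises the degree by `k - 1` and the
remaining `k - 1` differences lower it again. The result is exact: a combination of `C(N + k, q +
1)` minus constants with `q ≤ Σ n_j`, divided by `N`. Only `q = Σ n_j` reaches the top order, with
coefficient `∏ n_j! / (Σ n_j + 1)!`. -/

namespace RandomUnitary

/-! ### Haar measure on `U(N)`: invariance and selection rules. -/

instance instIsProbabilityMeasureHaar (N : ℕ) : IsProbabilityMeasure (haar N) := by
  constructor
  have := Measure.haarMeasure_self (K₀ := (⊤ : TopologicalSpace.PositiveCompacts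
    (Matrix.unitaryGroup (Fin N) ℂ)))
  simpa [haar] using this

instance instIsHaarMeasureHaar (N : ℕ) : (haar N).IsHaarMeasure := by
  unfold haar; infer_instance

theorem integral_haar_mul_left {N : ℕ} (V : Matrix.unitaryGroup (Fin N) ℂ)
    (F : Matrix.unitaryGroup (Fin N) ℂ → ℂ) : ∫ U, F (V * U) ∂(haar N) = ∫ U, F U ∂(haar N) :=
  integral_mul_left_eq_self F V

/-- A right translate of Haar measure is again a Haar probability measure, so uniqueness applies. -/
instance instIsMulRightInvariantHaar (N : ℕ) : (haar N).IsMulRightInvariant := by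
  constructor
  intro g
  have : IsProbabilityMeasure (Measure.map (· * g) (haar N)) :=
    Measure.isProbabilityMeasure_map (measurable_mul_const g).aemeasurable
  exact Measure.isHaarMeasure_eq_of_isProbabilityMeasure _ _

theorem integral_haar_mul_right {N : ℕ} (V : Matrix.unitaryGroup (Fin N) ℂ)
    (F : Matrix.unitaryGroup (Fin N) ℂ → ℂ) : ∫ U, F (U * V) ∂(haar N) = ∫ U, F U ∂(haar N) :=
  integral_mul_right_eq_self F V

theorem integrable_haar {N : ℕ} {F : Matrix.unitaryGroup (Fin N) ℂ → ℂ} (hF : Continuous F) :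
    Integrable F (haar N) :=
  hF.integrable_of_hasCompactSupport (HasCompactSupport.of_compactSpace F)

theorem integral_haar_swap {N : ℕ}
    {F : Matrix.unitaryGroup (Fin N) ℂ → Matrix.unitaryGroup (Fin N) ℂ → ℂ}
    (hF : Continuous (Function.uncurry F)) :
    ∫ U, ∫ V, F U V ∂(haar N) ∂(haar N) = ∫ V, ∫ U, F U V ∂(haar N) ∂(haar N) :=
  integral_integral_swap_of_hasCompactSupport hF (HasCompactSupport.of_compactSpace _)

/-- The integral equals `χ` times itself. Taking `V` to be a diagonal phase, this yields the
selection rules on monomials in the entries. -/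
theorem integral_haar_eq_zero_of_mul_right {N : ℕ} (V : Matrix.unitaryGroup (Fin N) ℂ) {χ : ℂ}
    (hχ : χ ≠ 1) {F : Matrix.unitaryGroup (Fin N) ℂ → ℂ} (hF : ∀ U, F (U * V) = χ * F U) :
    ∫ U, F U ∂(haar N) = 0 := by
  have h := integral_haar_mul_right V F
  simp only [hF, integral_const_mul] at h
  have : (χ - 1) * ∫ U, F U ∂(haar N) = 0 := by linear_combination h
  exact (mul_eq_zero.1 this).resolve_left (sub_ne_zero.2 hχ)

theorem integral_haar_eq_zero_of_mul_left {N : ℕ} (V : Matrix.unitaryGroup (Fin N) ℂ) {χ : ℂ}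
    (hχ : χ ≠ 1) {F : Matrix.unitaryGroup (Fin N) ℂ → ℂ} (hF : ∀ U, F (V * U) = χ * F U) :
    ∫ U, F U ∂(haar N) = 0 := by
  have h := integral_haar_mul_left V F
  simp only [hF, integral_const_mul] at h
  have : (χ - 1) * ∫ U, F U ∂(haar N) = 0 := by linear_combination h
  exact (mul_eq_zero.1 this).resolve_left (sub_ne_zero.2 hχ)

theorem continuous_entry {N : ℕ} (i j : Fin N) :
    Continuous fun U : Matrix.unitaryGroup (Fin N) ℂ => (U : Matrix (Fin N) (Fin N) ℂ) i j :=
  (continuous_subtype_val).matrix_elem i j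

theorem continuous_det_unitary {N : ℕ} :
    Continuous fun U : Matrix.unitaryGroup (Fin N) ℂ => (U : Matrix (Fin N) (Fin N) ℂ).det :=
  continuous_subtype_val.matrix_det

/-- The diagonal unitary matrix with `i`-th entry `z` and all other diagonal entries `1`. -/
noncomputable def phase {N : ℕ} (i : Fin N) (z : Circle) : Matrix.unitaryGroup (Fin N) ℂ :=
  ⟨Matrix.diagonal (Function.update 1 i (z : ℂ)), by
    rw [Matrix.mem_unitaryGroup_iff, Matrix.star_eq_conjTranspose, Matrix.diagonal_conjTranspose,
      Matrix.diagonal_mul_diagonal, ← Matrix.diagonal_one]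
    congr 1
    funext j
    rcases eq_or_ne j i with rfl | h
    · simp [Complex.mul_conj]
    · simp [h]⟩

theorem phase_mul_apply {N : ℕ} (i : Fin N) (z : Circle) (U : Matrix.unitaryGroup (Fin N) ℂ)
    (k l : Fin N) : (phase i z * U : Matrix.unitaryGroup (Fin N) ℂ).1 k l
      = (if k = i then (z : ℂ) else 1) * U.1 k l := by
  simp [phase, Matrix.diagonal_mul, Function.update_apply]

theorem mul_phase_apply {N : ℕ} (i : Fin N) (z : Circle) (U : Matrix.unitaryGroup (Fin N) ℂ)
    (k l : Fin N) : (U * phase i z : Matrix.unitaryGroup (Fin N) ℂ).1 k l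
      = (if l = i then (z : ℂ) else 1) * U.1 k l := by
  simp [phase, Matrix.mul_diagonal, Function.update_apply, mul_comm]

theorem det_phase {N : ℕ} (i : Fin N) (z : Circle) : (phase i z).1.det = z := by
  simp [phase, Matrix.det_diagonal, Finset.prod_update_of_mem]

theorem exists_circle_pow_ne {p q : ℕ} (h : p ≠ q) : ∃ z : Circle, (z : ℂ) ^ p ≠ (z : ℂ) ^ q := by
  -- Both exponents are below `p + q + 1`, and a primitive root of unity of that order has distinct
  -- powers there.
  obtain ⟨m, hm⟩ : ∃ m, m = p + q + 1 := ⟨_, rfl⟩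
  have hζ := Complex.isPrimitiveRoot_exp m (by omega)
  have hn : ‖Complex.exp (2 * Real.pi * Complex.I / m)‖ = 1 :=
    hζ.norm'_eq_one (by omega)
  refine ⟨⟨_, mem_sphere_zero_iff_norm.2 hn⟩, fun h' => h (hζ.pow_inj (by omega) (by omega) h')⟩

/-- The permutation matrix of `τ` as a unitary matrix. -/
noncomputable def permUnitary {N : ℕ} (τ : Equiv.Perm (Fin N)) : Matrix.unitaryGroup (Fin N) ℂ :=
  ⟨τ.permMatrix ℂ, by
    rw [Matrix.mem_unitaryGroup_iff, Matrix.star_eq_conjTranspose, Matrix.conjTranspose_permMatrix,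
      ← Matrix.permMatrix_mul]
    simp⟩

theorem permUnitary_mul_apply {N : ℕ} (τ : Equiv.Perm (Fin N)) (U : Matrix.unitaryGroup (Fin N) ℂ)
    (k l : Fin N) : (permUnitary τ * U : Matrix.unitaryGroup (Fin N) ℂ).1 k l = U.1 (τ k) l := by
  simp [permUnitary, Equiv.Perm.permMatrix, PEquiv.toMatrix_toPEquiv_mul]

theorem mul_permUnitary_apply {N : ℕ} (τ : Equiv.Perm (Fin N)) (U : Matrix.unitaryGroup (Fin N) ℂ)
    (k l : Fin N) : (U * permUnitary τ : Matrix.unitaryGroup (Fin N) ℂ).1 k l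
      = U.1 k (τ.symm l) := by
  simp [permUnitary, Equiv.Perm.permMatrix, PEquiv.mul_toMatrix_toPEquiv]

theorem det_permUnitary {N : ℕ} (τ : Equiv.Perm (Fin N)) :
    (permUnitary τ).1.det = ((Equiv.Perm.sign τ : ℤ) : ℂ) := by
  simp [permUnitary, Matrix.det_permutation]

/-! ### Symmetric functions of the eigenvalues. -/

/-- The elementary symmetric function of degree `r` in `u`. -/
noncomputable def elemSymm {N : ℕ} (r : ℕ) (u : Fin N → ℂ) : ℂ :=
  ∑ S ∈ Finset.powersetCard r Finset.univ, ∏ i ∈ S, u i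

/-- The complete homogeneous symmetric function of degree `a` in `u`. -/
noncomputable def completeSymm {N : ℕ} (a : ℕ) (u : Fin N → ℂ) : ℂ :=
  ∑ α ∈ Finset.piAntidiag Finset.univ a, ∏ i, u i ^ α i

theorem prod_one_add_mul_eq_sum_elemSymm {N : ℕ} (u : Fin N → ℂ) (x : ℂ) :
    ∏ i, (1 + x * u i) = ∑ r ∈ Finset.range (N + 1), elemSymm r u * x ^ r := by
  rw [Finset.prod_one_add, Finset.sum_powerset]
  simp only [Finset.card_univ, Fintype.card_fin]
  refine Finset.sum_congr rfl fun r _ => ?_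
  rw [elemSymm, Finset.sum_mul]
  refine Finset.sum_congr rfl fun S hS => ?_
  rw [Finset.prod_mul_distrib, Finset.prod_const, (Finset.mem_powersetCard.1 hS).2, mul_comm]

/-- On the unit circle the conjugate of `∏_S u` is the conjugate of the full product times `∏_{Sᶜ}
u`, and complementation exchanges sizes `c` and `N - c`. -/
theorem conj_elemSymm {N : ℕ} {u : Fin N → ℂ} (hu : ∀ i, ‖u i‖ = 1) {c : ℕ} (hc : c ≤ N) :
    starRingEnd ℂ (elemSymm c u) = starRingEnd ℂ (∏ i, u i) * elemSymm (N - c) u := by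
  rw [elemSymm, elemSymm, map_sum, Finset.mul_sum]
  refine Finset.sum_bij' (fun S _ => Sᶜ) (fun S _ => Sᶜ) ?_ ?_ ?_ ?_ ?_
  · intro S hS
    simp only [Finset.mem_powersetCard_univ] at hS ⊢
    rw [Finset.card_compl, hS, Fintype.card_fin]
  · intro S hS
    simp only [Finset.mem_powersetCard_univ] at hS ⊢
    rw [Finset.card_compl, hS, Fintype.card_fin]; omega
  · intro S _; simp
  · intro S _; simp
  · intro S _
    rw [← Finset.prod_mul_prod_compl S u, map_mul, mul_assoc, mul_comm (starRingEnd ℂ _) (∏ i ∈ Sᶜ, u i),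
      Complex.mul_conj, Complex.normSq_eq_norm_sq, norm_prod, Finset.prod_eq_one fun i _ => hu i]
    simp

open PowerSeries in
theorem coeff_prod_one_sub {N : ℕ} (u : Fin N → ℂ) (c : ℕ) :
    PowerSeries.coeff c (∏ i, (1 - PowerSeries.C (u i) * PowerSeries.X)) =
      (-1) ^ c * elemSymm c u := by
  have h1 : ∏ i, (1 - PowerSeries.C (u i) * PowerSeries.X) =
      ∑ S ∈ (Finset.univ : Finset (Fin N)).powerset,
        PowerSeries.C ((-1) ^ S.card * ∏ i ∈ S, u i) * PowerSeries.X ^ S.card := by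
    simp only [sub_eq_add_neg]
    rw [Finset.prod_one_add]
    refine Finset.sum_congr rfl fun S _ => ?_
    rw [Finset.prod_neg, Finset.prod_mul_distrib, Finset.prod_const, map_mul, map_prod]
    simp [mul_assoc]
  rw [h1, map_sum, elemSymm, Finset.mul_sum]
  simp only [PowerSeries.coeff_C_mul, PowerSeries.coeff_X_pow, mul_ite, mul_one, mul_zero]
  rw [← Finset.sum_filter]
  refine Finset.sum_congr ?_ ?_
  · ext S; simp [eq_comm]
  · intro S hS
    rw [(Finset.mem_powersetCard_univ.1 hS)]

theorem coeff_prod_geometric {N : ℕ} (u : Fin N → ℂ) (a : ℕ) :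
    PowerSeries.coeff a (∏ i, PowerSeries.mk fun m => u i ^ m) = completeSymm a u := by
  rw [PowerSeries.coeff_prod, completeSymm]
  refine Finset.sum_bij' (fun α _ => ⇑α) (fun α _ => Finsupp.equivFunOnFinite.symm α) ?_ ?_ ?_ ?_ ?_
  · intro α hα; simpa using hα
  · intro α hα; simpa using hα
  · intro α _; ext; simp
  · intro α _; rfl
  · intro α _; simp

theorem geometric_mul_one_sub (z : ℂ) :
    (PowerSeries.mk fun m => z ^ m) * (1 - PowerSeries.C z * PowerSeries.X) = 1 := by
  ext m
  rw [mul_sub, map_sub, mul_one, mul_comm (PowerSeries.C z), ← mul_assoc]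
  cases m with
  | zero => simp
  | succ m =>
    rw [PowerSeries.coeff_mul_C, PowerSeries.coeff_succ_mul_X]
    simp [PowerSeries.coeff_one, pow_succ]

/-- This is the logarithmic derivative of `∏ (1 - u_i X)`, whose inverse is the product of geometric
series. Its coefficients on the right are power sums. -/
theorem neg_deriv_prod_mul_geometric {N : ℕ} (u : Fin N → ℂ) (s : Finset (Fin N)) :
    -PowerSeries.derivative ℂ (∏ i ∈ s, (1 - PowerSeries.C (u i) * PowerSeries.X)) *
        (∏ i ∈ s, PowerSeries.mk fun m => u i ^ m) =
      ∑ i ∈ s, PowerSeries.C (u i) * PowerSeries.mk fun m => u i ^ m := by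
  classical
  induction s using Finset.induction_on with
  | empty => simp
  | insert i s hi ih =>
    have h1 : (∏ i ∈ s, PowerSeries.mk fun m => u i ^ m) *
        (∏ i ∈ s, (1 - PowerSeries.C (u i) * PowerSeries.X)) = 1 := by
      rw [← Finset.prod_mul_distrib]
      exact Finset.prod_eq_one fun i _ => geometric_mul_one_sub (u i)
    have h2 : PowerSeries.derivative ℂ (1 - PowerSeries.C (u i) * PowerSeries.X) =
        -PowerSeries.C (u i) := by
      rw [map_sub, Derivation.leibniz, PowerSeries.derivative_X, PowerSeries.derivative_C]
      simp
    rw [Finset.prod_insert hi, Finset.prod_insert hi, Finset.sum_insert hi, ← ih,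
      Derivation.leibniz, h2, smul_eq_mul, smul_eq_mul]
    have h3 := geometric_mul_one_sub (u i)
    linear_combination (PowerSeries.C (u i) * PowerSeries.mk fun m => u i ^ m) * h1 -
      (PowerSeries.derivative ℂ (∏ i ∈ s, (1 - PowerSeries.C (u i) * PowerSeries.X)) *
        (∏ i ∈ s, PowerSeries.mk fun m => u i ^ m)) * h3

/-- Power sums in terms of elementary and complete homogeneous symmetric functions. -/
theorem sum_pow_eq_sum_elemSymm_mul_completeSymm {N : ℕ} (u : Fin N → ℂ) {R : ℕ} (hR : 1 ≤ R) :
    ∑ i, u i ^ R = ∑ c ∈ Finset.range (R + 1),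
      (-1) ^ (c + 1) * (c : ℂ) * elemSymm c u * completeSymm (R - c) u := by
  obtain ⟨R, rfl⟩ : ∃ m, R = m + 1 := ⟨R - 1, by omega⟩
  have h := congrArg (PowerSeries.coeff R) (neg_deriv_prod_mul_geometric u Finset.univ)
  rw [PowerSeries.coeff_mul, map_sum, Finset.Nat.sum_antidiagonal_eq_sum_range_succ_mk] at h
  simp only [PowerSeries.coeff_C_mul, PowerSeries.coeff_mk, map_neg, PowerSeries.coeff_derivative,
    coeff_prod_geometric, coeff_prod_one_sub, ← pow_succ'] at h
  rw [← h, Finset.sum_range_succ' _ (R + 1)]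
  simp only [Nat.cast_zero, mul_zero, zero_mul, add_zero]
  refine Finset.sum_congr rfl fun c _ => ?_
  rw [Nat.add_sub_add_right]
  push_cast
  ring

/-! ### Sums of principal minors. -/

/-- The index set for the expansion of the sum of the principal minors of size `r`. -/
def minorIndex (N r : ℕ) : Finset (Finset (Fin N) × Equiv.Perm (Fin N)) :=
  Finset.univ.filter fun p => p.1.card = r ∧ ∀ i ∉ p.1, p.2 i = i

/-- The sum of the principal `r × r` minors of `M`. -/
noncomputable def minorSum {N : ℕ} (r : ℕ) (M : Matrix (Fin N) (Fin N) ℂ) : ℂ :=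
  ∑ p ∈ minorIndex N r, ((Equiv.Perm.sign p.2 : ℤ) : ℂ) * ∏ i ∈ p.1, M i (p.2 i)

/-- In the Leibniz expansion `S` records the rows where the term `x • M` is taken; the identity
contributes on the other rows only if the permutation fixes them. -/
theorem det_one_add_smul_eq_sum_minorSum {N : ℕ} (M : Matrix (Fin N) (Fin N) ℂ) (x : ℂ) :
    (1 + x • M).det = ∑ r ∈ Finset.range (N + 1), minorSum r M * x ^ r := by
  rw [← Matrix.det_transpose, Matrix.det_apply']
  have h1 : ∀ σ : Equiv.Perm (Fin N), ∏ i, (1 + x • M).transpose (σ i) i =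
      ∑ S : Finset (Fin N), (if ∀ i ∉ S, σ i = i then x ^ S.card * ∏ i ∈ S, M i (σ i) else 0) := by
    intro σ
    simp only [Matrix.transpose_apply, Matrix.add_apply, Matrix.smul_apply, smul_eq_mul]
    rw [show ∏ i, ((1 : Matrix (Fin N) (Fin N) ℂ) i (σ i) + x * M i (σ i)) =
      ∏ i, (x * M i (σ i) + (1 : Matrix (Fin N) (Fin N) ℂ) i (σ i)) from
        Finset.prod_congr rfl fun _ _ => add_comm _ _, Finset.prod_add, Finset.powerset_univ]
    refine Finset.sum_congr rfl fun S _ => ?_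
    rw [Finset.prod_mul_distrib, Finset.prod_const]
    split_ifs with h
    · rw [Finset.prod_eq_one (s := Finset.univ \ S), mul_one]
      intro i hi
      rw [h i (by simpa using hi), Matrix.one_apply_eq]
    · push Not at h
      obtain ⟨i, hi, hσ⟩ := h
      have h0 : (1 : Matrix (Fin N) (Fin N) ℂ) i (σ i) = 0 := Matrix.one_apply_ne (Ne.symm hσ)
      have hi' : i ∈ Finset.univ \ S := by simpa using hi
      rw [Finset.prod_eq_zero hi' h0, mul_zero]
  simp only [h1, minorSum, Finset.sum_mul, Finset.mul_sum]
  simp only [minorIndex, Finset.sum_filter, Fintype.sum_prod_type]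
  rw [Finset.sum_comm]
  conv_rhs => rw [Finset.sum_comm]
  refine Finset.sum_congr rfl fun S _ => ?_
  rw [Finset.sum_comm]
  refine Finset.sum_congr rfl fun σ _ => ?_
  rw [Finset.sum_eq_single S.card]
  · by_cases h : ∀ i ∉ S, σ i = i
    · rw [if_pos h, if_pos ⟨rfl, h⟩]; ring
    · simp [h]
  · intro r _ hr
    rw [if_neg]; rintro ⟨h, _⟩; exact hr h.symm
  · intro h
    exfalso; apply h
    have := Finset.card_le_univ S
    simp at this ⊢; omega

/-! ### Diagonalization of unitary matrices. -/

/-- A unitary matrix is unitarily diagonalizable. -/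
theorem exists_unitary_diagonal {N : ℕ} (U : Matrix.unitaryGroup (Fin N) ℂ) :
    ∃ (W : Matrix.unitaryGroup (Fin N) ℂ) (u : Fin N → ℂ),
      (U : Matrix (Fin N) (Fin N) ℂ) = W.1 * Matrix.diagonal u * star W.1 := by
  -- Cayley transform: for a unimodular `μ` outside the finite spectrum, `H = i(μ + U)(μ - U)⁻¹` is
  -- Hermitian, and its spectral theorem diagonalizes `U`.
  obtain ⟨μ, hμ1, hμ⟩ : ∃ μ : ℂ, ‖μ‖ = 1 ∧ (Matrix.scalar (Fin N) μ - U.1).det ≠ 0 := by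
    by_contra! h
    have hfin : ({x | U.1.charpoly.IsRoot x}).Finite :=
      Polynomial.finite_setOfPred_isRoot (Matrix.charpoly_monic _).ne_zero
    have : Infinite (Set.Ioc (-Real.pi) Real.pi) :=
      (Set.Ioc_infinite (by linarith [Real.pi_pos])).to_subtype
    have hC : Infinite Circle := Circle.argEquiv.infinite_iff.2 this
    have hinf := @Set.infinite_range_of_injective Circle ℂ hC _ Circle.coe_injective
    refine hinf (hfin.subset ?_)
    rintro _ ⟨z, rfl⟩
    rw [Set.mem_ofPred_eq, Polynomial.IsRoot, Matrix.eval_charpoly]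
    exact h z (Circle.norm_coe z)
  have hUU : star U.1 * U.1 = 1 := (Matrix.mem_unitaryGroup_iff').1 U.2
  have hμμ : starRingEnd ℂ μ * μ = 1 := by
    rw [mul_comm, Complex.mul_conj, Complex.normSq_eq_norm_sq, hμ1]; simp
  set A := Matrix.scalar (Fin N) μ - U.1 with hA
  have hAdet : IsUnit A.det := isUnit_iff_ne_zero.2 hμ
  set B := Matrix.scalar (Fin N) μ + U.1 with hB
  set H := Complex.I • (B * A⁻¹) with hH
  have hHA : H * A = Complex.I • B := by
    rw [hH, smul_mul_assoc, mul_assoc, Matrix.nonsing_inv_mul _ hAdet, mul_one]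
  have hAB : star A * B = -(star B * A) := by
    have hs : star (Matrix.scalar (Fin N) μ) = Matrix.scalar (Fin N) (starRingEnd ℂ μ) := by
      simp [Matrix.star_eq_conjTranspose, Matrix.diagonal_conjTranspose]
    have hss : Matrix.scalar (Fin N) (starRingEnd ℂ μ) * Matrix.scalar (Fin N) μ = 1 := by
      rw [← map_mul, hμμ, map_one]
    rw [hA, hB, star_sub, star_add, hs]
    simp only [sub_mul, add_mul, mul_add, mul_sub, hss, hUU]
    abel
  have hHerm : H.IsHermitian := by
    have h1 : star A * star H * A = star A * H * A := by
      rw [← star_mul, hHA, mul_assoc, hHA, star_smul, smul_mul_assoc, mul_smul_comm, hAB]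
      simp
    have h2 := congrArg (fun X => (star A)⁻¹ * X * A⁻¹) h1
    have hAdet' : IsUnit (star A).det := by
      rw [Matrix.star_eq_conjTranspose, Matrix.det_conjTranspose]; exact hAdet.star
    have h3 : star H = H := by
      simpa [mul_assoc, Matrix.mul_nonsing_inv _ hAdet, ← mul_assoc (star A)⁻¹ (star A),
        Matrix.nonsing_inv_mul _ hAdet'] using h2
    exact h3
  set W := hHerm.eigenvectorUnitary with hW
  set d := hHerm.eigenvalues with hd
  have hspec : H = W.1 * Matrix.diagonal (fun i => (d i : ℂ)) * star W.1 := by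
    conv_lhs => rw [hHerm.spectral_theorem]
    rfl
  have hWW : star W.1 * W.1 = 1 := (Matrix.mem_unitaryGroup_iff').1 W.2
  have hWW' : W.1 * star W.1 = 1 := (Matrix.mem_unitaryGroup_iff).1 W.2
  have hdI : ∀ i, (d i : ℂ) + Complex.I ≠ 0 := by
    intro i h
    have := congrArg Complex.im h
    simp at this
  -- Solving `d(μ - x) = i(μ + x)` for `x`; the denominator is nonzero because `d` is real.
  refine ⟨W, fun i => μ * (d i - Complex.I) / (d i + Complex.I), ?_⟩
  set X := star W.1 * U.1 * W.1 with hX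
  have hUX : U.1 = W.1 * X * star W.1 := by
    rw [hX]
    simp only [mul_assoc, hWW', mul_one]
    rw [← mul_assoc, hWW', one_mul]
  suffices hXd : X = Matrix.diagonal fun i => μ * (d i - Complex.I) / (d i + Complex.I) by
    rw [← hXd]; exact hUX
  have h3 : Matrix.diagonal (fun i => (d i : ℂ)) * (Matrix.scalar (Fin N) μ - X) =
      Complex.I • (Matrix.scalar (Fin N) μ + X) := by
    have h4 := congrArg (fun Y => star W.1 * Y * W.1) hHA
    have hsc : star W.1 * Matrix.scalar (Fin N) μ * W.1 = Matrix.scalar (Fin N) μ := by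
      rw [mul_assoc, Matrix.scalar_comm _ (fun r => Commute.all _ _), ← mul_assoc, hWW, one_mul]
    have h5 : star W.1 * A * W.1 = Matrix.scalar (Fin N) μ - X := by
      rw [hA, mul_sub, sub_mul, hsc]
    have h6 : star W.1 * B * W.1 = Matrix.scalar (Fin N) μ + X := by
      rw [hB, mul_add, add_mul, hsc]
    rw [← h5, ← h6]
    simp only [hspec] at h4
    simp only [mul_smul_comm, smul_mul_assoc] at h4
    rw [← h4]
    simp only [← mul_assoc, hWW, one_mul]
  ext i j
  have h7 := congrFun (congrFun h3 i) j
  simp only [Matrix.diagonal_mul, Matrix.sub_apply, Matrix.smul_apply, Matrix.add_apply,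
    Matrix.scalar_apply, smul_eq_mul, Matrix.diagonal_apply] at h7 ⊢
  split_ifs with hij
  · rw [if_pos hij] at h7
    rw [eq_div_iff (hdI i)]
    linear_combination -h7
  · rw [if_neg hij] at h7
    have : (d i + Complex.I) * X i j = 0 := by linear_combination -h7
    exact (mul_eq_zero.1 this).resolve_left (hdI i)

theorem charpoly_unitary_conj {N : ℕ} (W : Matrix.unitaryGroup (Fin N) ℂ)
    (M : Matrix (Fin N) (Fin N) ℂ) : (W.1 * M * star W.1).charpoly = M.charpoly := by
  rw [mul_assoc, Matrix.charpoly_mul_comm, mul_assoc, (Matrix.mem_unitaryGroup_iff').1 W.2, mul_one]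

theorem det_unitary_conj {N : ℕ} (W : Matrix.unitaryGroup (Fin N) ℂ)
    (M : Matrix (Fin N) (Fin N) ℂ) : (W.1 * M * star W.1).det = M.det := by
  rw [Matrix.det_mul_right_comm, (Matrix.mem_unitaryGroup_iff).1 W.2, one_mul]

theorem eq_of_sum_mul_pow_eq {N : ℕ} {a b : ℕ → ℂ}
    (h : ∀ x : ℂ, ∑ r ∈ Finset.range N, a r * x ^ r = ∑ r ∈ Finset.range N, b r * x ^ r)
    {r : ℕ} (hr : r < N) : a r = b r := by
  have h1 : ∑ r ∈ Finset.range N, Polynomial.C (a r) * Polynomial.X ^ r =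
      ∑ r ∈ Finset.range N, Polynomial.C (b r) * Polynomial.X ^ r := by
    refine Polynomial.funext fun x => ?_
    simpa [Polynomial.eval_finsetSum] using h x
  have h2 := congrArg (Polynomial.coeff · r) h1
  simpa [Polynomial.finsetSum_coeff, Polynomial.coeff_C_mul, Polynomial.coeff_X_pow, hr] using h2

theorem minorSum_eq_zero {N r : ℕ} (hr : N < r) (M : Matrix (Fin N) (Fin N) ℂ) :
    minorSum r M = 0 := by
  refine Finset.sum_eq_zero fun p hp => ?_
  have h1 := (Finset.mem_filter.1 hp).2.1
  have h2 := Finset.card_le_univ p.1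
  simp at h2
  omega

/-- Minor sums are the coefficients of `det (1 + xM)`, which is invariant under conjugation. -/
theorem minorSum_unitary_conj {N : ℕ} (r : ℕ) (W : Matrix.unitaryGroup (Fin N) ℂ)
    (M : Matrix (Fin N) (Fin N) ℂ) : minorSum r (W.1 * M * star W.1) = minorSum r M := by
  rcases le_or_gt r N with hr | hr
  · refine eq_of_sum_mul_pow_eq (N := N + 1) (a := fun r => minorSum r (W.1 * M * star W.1))
      (b := fun r => minorSum r M) (fun x => ?_) (by omega)
    rw [← det_one_add_smul_eq_sum_minorSum, ← det_one_add_smul_eq_sum_minorSum,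
      ← det_unitary_conj W (1 + x • M)]
    have hWW' : W.1 * star W.1 = 1 := (Matrix.mem_unitaryGroup_iff).1 W.2
    rw [mul_add, add_mul, mul_one, hWW', mul_smul_comm, smul_mul_assoc]
  · rw [minorSum_eq_zero hr, minorSum_eq_zero hr]

theorem minorSum_diagonal {N : ℕ} {r : ℕ} (hr : r ≤ N) (u : Fin N → ℂ) :
    minorSum r (Matrix.diagonal u) = elemSymm r u := by
  refine eq_of_sum_mul_pow_eq (N := N + 1) (a := fun r => minorSum r (Matrix.diagonal u))
    (b := fun r => elemSymm r u) (fun x => ?_) (by omega)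
  rw [← det_one_add_smul_eq_sum_minorSum, ← prod_one_add_mul_eq_sum_elemSymm,
    ← Matrix.diagonal_one, ← Matrix.diagonal_smul, Matrix.diagonal_add, Matrix.det_diagonal]
  rfl

theorem roots_charpoly_unitary_diagonal {N : ℕ} (W : Matrix.unitaryGroup (Fin N) ℂ)
    (u : Fin N → ℂ) :
    (W.1 * Matrix.diagonal u * star W.1).charpoly.roots = Finset.univ.val.map u := by
  rw [charpoly_unitary_conj, Matrix.charpoly_diagonal]
  have h := Polynomial.roots_multiset_prod_X_sub_C (Finset.univ.val.map u)
  rwa [Multiset.map_map] at h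

theorem norm_eq_one_of_unitary_diagonal {N : ℕ} {U W : Matrix.unitaryGroup (Fin N) ℂ}
    {u : Fin N → ℂ} (h : U.1 = W.1 * Matrix.diagonal u * star W.1) (i : Fin N) : ‖u i‖ = 1 := by
  have hWW : star W.1 * W.1 = 1 := (Matrix.mem_unitaryGroup_iff').1 W.2
  have hD : Matrix.diagonal u = (star W * U * W : Matrix.unitaryGroup (Fin N) ℂ).1 := by
    simp only [Submonoid.coe_mul, Unitary.coe_star, h]
    simp only [mul_assoc, hWW, mul_one]
    rw [← mul_assoc, hWW, one_mul]
  have h2 := (Matrix.mem_unitaryGroup_iff).1 (star W * U * W : Matrix.unitaryGroup (Fin N) ℂ).2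
  rw [← hD, Matrix.star_eq_conjTranspose, Matrix.diagonal_conjTranspose,
    Matrix.diagonal_mul_diagonal, ← Matrix.diagonal_one] at h2
  have h3 := congrFun (Matrix.diagonal_injective h2) i
  simp only [Pi.star_apply, RCLike.star_def, Complex.mul_conj, Complex.normSq_eq_norm_sq] at h3
  have h4 : ‖u i‖ ^ 2 = 1 := by exact_mod_cast h3
  nlinarith [norm_nonneg (u i)]

/-! ### Moments of the first row. -/

/-- The moment `𝔼 |U₀₀|^{2a}` of a matrix entry. -/
noncomputable def entryMoment (n a : ℕ) : ℂ :=
  ∫ U : Matrix.unitaryGroup (Fin (n + 1)) ℂ, U.1 0 0 ^ a * starRingEnd ℂ (U.1 0 0) ^ a ∂(haar (n + 1))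

theorem exists_unitary_first_column {n : ℕ} (w : Fin (n + 1) → ℝ) (hw : ∑ i, w i ^ 2 = 1) :
    ∃ W : Matrix.unitaryGroup (Fin (n + 1)) ℂ, ∀ i, W.1 i 0 = w i := by
  let v : Fin (n + 1) → EuclideanSpace ℂ (Fin (n + 1)) := fun _ =>
    WithLp.toLp 2 fun i => (w i : ℂ)
  have hv : Orthonormal ℂ (({0} : Set (Fin (n + 1))).domRestrict v) := by
    constructor
    · intro i
      simp [v, EuclideanSpace.norm_eq, hw]
    · intro i j hij
      exact absurd (Subsingleton.elim i j) hij
  obtain ⟨b, hb⟩ := hv.exists_orthonormalBasis_extension_of_card_eq (by simp)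
  refine ⟨⟨_, (EuclideanSpace.basisFun (Fin (n + 1)) ℂ).toMatrix_orthonormalBasis_mem_unitary b⟩,
    fun i => ?_⟩
  simp [Module.Basis.toMatrix_apply, hb, v]

/-- A real unit vector is the first column of some unitary `W`, so the normalized linear form is the
corner entry of `V * W`, and right invariance leaves only the norm of `w`. -/
theorem integral_linearForm_pow {n : ℕ} (a : ℕ) (w : Fin (n + 1) → ℝ) :
    ∫ V : Matrix.unitaryGroup (Fin (n + 1)) ℂ, (∑ i, (w i : ℂ) * V.1 0 i) ^ a *
      (∑ i, (w i : ℂ) * starRingEnd ℂ (V.1 0 i)) ^ a ∂(haar (n + 1)) =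
      entryMoment n a * (∑ i, (w i : ℂ) ^ 2) ^ a := by
  rcases eq_or_ne (∑ i, w i ^ 2) 0 with h | h
  · have h0 : ∀ i, w i = 0 := fun i => by
      have := (Finset.sum_eq_zero_iff_of_nonneg (fun i _ => sq_nonneg (w i))).1 h i
        (Finset.mem_univ i)
      simpa using this
    rcases eq_or_ne a 0 with rfl | ha
    · simp [entryMoment]
    · simp [h0, ha]
  · set t := Real.sqrt (∑ i, w i ^ 2) with ht
    have hpos : 0 < ∑ i, w i ^ 2 :=
      lt_of_le_of_ne (Finset.sum_nonneg fun i _ => sq_nonneg _) (Ne.symm h)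
    have htpos : 0 < t := Real.sqrt_pos.2 hpos
    have htt : t ^ 2 = ∑ i, w i ^ 2 := Real.sq_sqrt hpos.le
    obtain ⟨W, hW⟩ := exists_unitary_first_column (fun i => w i / t) (by
      simp only [div_pow, ← Finset.sum_div]
      rw [← htt]; field_simp)
    rw [entryMoment, ← integral_haar_mul_right W
      (fun U => U.1 0 0 ^ a * starRingEnd ℂ (U.1 0 0) ^ a), ← integral_mul_const]
    refine integral_congr_ae (.of_forall fun V => ?_)
    have h1 : (V * W : Matrix.unitaryGroup (Fin (n + 1)) ℂ).1 0 0 =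
        (∑ i, (w i : ℂ) * V.1 0 i) / t := by
      simp only [Submonoid.coe_mul, Matrix.mul_apply, hW, Finset.sum_div]
      refine Finset.sum_congr rfl fun i _ => ?_
      push_cast; ring
    have h2 : (∑ i, (w i : ℂ) * starRingEnd ℂ (V.1 0 i)) =
        starRingEnd ℂ (∑ i, (w i : ℂ) * V.1 0 i) := by
      simp [map_sum]
    have htc : (t : ℂ) ≠ 0 := by exact_mod_cast htpos.ne'
    have h3 : ∑ i, (w i : ℂ) ^ 2 = (t : ℂ) ^ 2 := by exact_mod_cast htt.symm
    simp only []
    rw [h1, h2, h3, map_div₀, Complex.conj_ofReal, ← mul_pow, ← mul_pow, ← mul_pow]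
    congr 1
    field_simp

theorem continuous_row_monomial {n : ℕ} (α β : Fin (n + 1) → ℕ) :
    Continuous fun V : Matrix.unitaryGroup (Fin (n + 1)) ℂ =>
      (∏ i, V.1 0 i ^ α i) * ∏ i, starRingEnd ℂ (V.1 0 i) ^ β i := by
  refine Continuous.mul (continuous_finsetProd _ fun i _ => (continuous_entry 0 i).pow _)
    (continuous_finsetProd _ fun i _ => (Complex.continuous_conj.comp (continuous_entry 0 i)).pow _)

theorem integral_row_monomial_eq_zero {n : ℕ} {α β : Fin (n + 1) → ℕ} (h : α ≠ β) :
    ∫ V : Matrix.unitaryGroup (Fin (n + 1)) ℂ,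
      (∏ i, V.1 0 i ^ α i) * ∏ i, starRingEnd ℂ (V.1 0 i) ^ β i ∂(haar (n + 1)) = 0 := by
  obtain ⟨j, hj⟩ := Function.ne_iff.1 h
  obtain ⟨z, hz⟩ := exists_circle_pow_ne hj
  have hzz : (z : ℂ) * starRingEnd ℂ (z : ℂ) = 1 := by
    rw [Complex.mul_conj, Complex.normSq_eq_norm_sq, Circle.norm_coe]; simp
  refine integral_haar_eq_zero_of_mul_right (phase j z)
    (χ := (z : ℂ) ^ α j * starRingEnd ℂ (z : ℂ) ^ β j) ?_ ?_
  · intro h1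
    apply hz
    have : (z : ℂ) ^ β j * starRingEnd ℂ (z : ℂ) ^ β j = 1 := by rw [← mul_pow, hzz, one_pow]
    calc (z : ℂ) ^ α j = (z : ℂ) ^ α j * ((z : ℂ) ^ β j * starRingEnd ℂ (z : ℂ) ^ β j) := by
          rw [this, mul_one]
      _ = ((z : ℂ) ^ α j * starRingEnd ℂ (z : ℂ) ^ β j) * (z : ℂ) ^ β j := by ring
      _ = _ := by rw [h1, one_mul]
  · intro U
    simp only [mul_phase_apply, map_mul, mul_pow, Finset.prod_mul_distrib, apply_ite, map_one]
    simp only [ite_pow, one_pow, Finset.prod_ite_eq', Finset.mem_univ, if_true]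
    ring

/-- Expand `integral_linearForm_pow` by the multinomial theorem: only equal exponents survive, and
both sides become polynomials in the `w_i²` whose coefficients can be compared. -/
theorem integral_row_monomial {n a : ℕ} {α : Fin (n + 1) → ℕ} (hα : ∑ i, α i = a) :
    (Nat.multinomial Finset.univ α : ℂ) * ∫ V : Matrix.unitaryGroup (Fin (n + 1)) ℂ,
      (∏ i, V.1 0 i ^ α i) * ∏ i, starRingEnd ℂ (V.1 0 i) ^ α i ∂(haar (n + 1)) =
      entryMoment n a := by
  set M : (Fin (n + 1) → ℕ) → ℂ := fun α => ∫ V : Matrix.unitaryGroup (Fin (n + 1)) ℂ,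
      (∏ i, V.1 0 i ^ α i) * ∏ i, starRingEnd ℂ (V.1 0 i) ^ α i ∂(haar (n + 1)) with hM
  have key : ∀ w : Fin (n + 1) → ℝ,
      ∑ α ∈ Finset.piAntidiag Finset.univ a, (Nat.multinomial Finset.univ α : ℂ) ^ 2 * M α *
        ∏ i, ((w i : ℂ) ^ 2) ^ α i =
      ∑ α ∈ Finset.piAntidiag Finset.univ a, entryMoment n a * (Nat.multinomial Finset.univ α : ℂ) *
        ∏ i, ((w i : ℂ) ^ 2) ^ α i := by
    intro w
    have h := integral_linearForm_pow a w
    rw [Finset.sum_pow_eq_sum_piAntidiag] at h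
    simp only [mul_assoc]
    rw [← Finset.mul_sum, ← h]
    have h1 : ∀ V : Matrix.unitaryGroup (Fin (n + 1)) ℂ, (∑ i, (w i : ℂ) * V.1 0 i) ^ a *
        (∑ i, (w i : ℂ) * starRingEnd ℂ (V.1 0 i)) ^ a =
        ∑ α ∈ Finset.piAntidiag Finset.univ a, ∑ β ∈ Finset.piAntidiag Finset.univ a,
          (Nat.multinomial Finset.univ α : ℂ) * (Nat.multinomial Finset.univ β : ℂ) *
          (∏ i, (w i : ℂ) ^ α i) * (∏ i, (w i : ℂ) ^ β i) *
          ((∏ i, V.1 0 i ^ α i) * ∏ i, starRingEnd ℂ (V.1 0 i) ^ β i) := by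
      intro V
      rw [Finset.sum_pow_eq_sum_piAntidiag, Finset.sum_pow_eq_sum_piAntidiag, Finset.sum_mul_sum]
      refine Finset.sum_congr rfl fun α _ => Finset.sum_congr rfl fun β _ => ?_
      simp only [mul_pow, Finset.prod_mul_distrib]
      ring
    simp only [h1]
    rw [integral_finsetSum _ fun α _ => integrable_finsetSum _ fun β _ =>
      (integrable_haar (continuous_row_monomial α β)).const_mul _]
    refine Finset.sum_congr rfl fun α hα => ?_
    rw [integral_finsetSum _ fun β _ => (integrable_haar (continuous_row_monomial α β)).const_mul _]
    rw [Finset.sum_eq_single α]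
    · rw [integral_const_mul]
      have h2 : ∏ i, ((w i : ℂ) ^ 2) ^ α i = (∏ i, (w i : ℂ) ^ α i) * ∏ i, (w i : ℂ) ^ α i := by
        rw [← Finset.prod_mul_distrib]
        exact Finset.prod_congr rfl fun i _ => by ring
      rw [h2, hM]
      ring
    · intro β _ hβ
      rw [integral_const_mul, integral_row_monomial_eq_zero (Ne.symm hβ), mul_zero]
    · intro h; exact absurd hα h
  have hpoly : ∑ α ∈ Finset.piAntidiag Finset.univ a,
        MvPolynomial.monomial (Finsupp.equivFunOnFinite.symm α)
          ((Nat.multinomial Finset.univ α : ℂ) ^ 2 * M α) =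
      ∑ α ∈ Finset.piAntidiag Finset.univ a,
        MvPolynomial.monomial (Finsupp.equivFunOnFinite.symm α)
          (entryMoment n a * (Nat.multinomial Finset.univ α : ℂ)) := by
    -- The identity is known only where the variables are squares of reals; nonnegative reals form
    -- an infinite set in each coordinate, which suffices.
    refine MvPolynomial.funext_set (fun _ : Fin (n + 1) => Complex.ofReal '' Set.Ici 0)
      (fun _ => (Set.Ici_infinite 0).image Complex.ofReal_injective.injOn) fun x hx => ?_
    have hx' : ∀ i, ∃ w : ℝ, x i = (w : ℂ) ^ 2 := by
      intro i
      obtain ⟨t, ht, htx⟩ := hx i (Set.mem_univ i)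
      exact ⟨Real.sqrt t, by rw [← htx]; exact_mod_cast (Real.sq_sqrt ht).symm⟩
    choose w hw using hx'
    have := key w
    simp only [← hw] at this
    simpa [MvPolynomial.eval_monomial, Finsupp.prod_fintype] using this
  have h2 := congrArg (MvPolynomial.coeff (Finsupp.equivFunOnFinite.symm α)) hpoly
  simp only [MvPolynomial.coeff_sum, MvPolynomial.coeff_monomial, EmbeddingLike.apply_eq_iff_eq,
    Finset.sum_ite_eq', Finset.mem_piAntidiag, Finset.mem_univ, implies_true, and_true, hα,
    if_true] at h2
  have hne : (Nat.multinomial Finset.univ α : ℂ) ≠ 0 := by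
    exact_mod_cast (Nat.multinomial_pos Finset.univ α).ne'
  apply mul_left_cancel₀ hne
  rw [← mul_assoc, ← sq, h2, mul_comm]

/-- The corner entry is `Σ u_i |V_{0i}|²`. The multinomial coefficients cancel against the row
moments, so every monomial of degree `a` gets the same weight. -/
theorem integral_conj_diagonal_pow {n : ℕ} (a : ℕ) (u : Fin (n + 1) → ℂ) :
    ∫ V : Matrix.unitaryGroup (Fin (n + 1)) ℂ,
      ((V.1 * Matrix.diagonal u * star V.1) 0 0) ^ a ∂(haar (n + 1)) =
      entryMoment n a * completeSymm a u := by
  have h1 : ∀ V : Matrix.unitaryGroup (Fin (n + 1)) ℂ,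
      ((V.1 * Matrix.diagonal u * star V.1) 0 0) ^ a =
      ∑ α ∈ Finset.piAntidiag Finset.univ a, (∏ i, u i ^ α i) *
        ((Nat.multinomial Finset.univ α : ℂ) *
          ((∏ i, V.1 0 i ^ α i) * ∏ i, starRingEnd ℂ (V.1 0 i) ^ α i)) := by
    intro V
    rw [Matrix.mul_apply, Finset.sum_pow_eq_sum_piAntidiag]
    refine Finset.sum_congr rfl fun α _ => ?_
    simp only [Matrix.mul_diagonal, Matrix.star_apply, mul_pow, Finset.prod_mul_distrib,
      RCLike.star_def]
    ring
  simp only [h1]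
  rw [integral_finsetSum _ fun α _ =>
    ((integrable_haar (continuous_row_monomial α α)).const_mul _).const_mul _, completeSymm,
    Finset.mul_sum]
  refine Finset.sum_congr rfl fun α hα => ?_
  rw [integral_const_mul, integral_const_mul, integral_row_monomial
    (Finset.mem_piAntidiag.1 hα).1, mul_comm]

theorem completeSymm_one (n a : ℕ) :
    completeSymm a (1 : Fin (n + 1) → ℂ) = ((n + a).choose a : ℂ) := by
  have h : (Finset.piAntidiag (Finset.univ : Finset (Fin (n + 1))) a).card =
      (Finset.finsuppAntidiag (Finset.univ : Finset (Fin (n + 1))) a).card := by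
    refine Finset.card_bij' (fun α _ => Finsupp.equivFunOnFinite.symm α) (fun α _ => ⇑α)
      ?_ ?_ ?_ ?_
    · intro α hα; simpa using hα
    · intro α hα; simpa using hα
    · intro α _; rfl
    · intro α _; ext; simp
  rw [Finset.card_finsuppAntidiag_nat_eq_choose] at h
  simp only [Finset.card_univ, Fintype.card_fin, show n + 1 + a - 1 = n + a by omega] at h
  simp [completeSymm, h]

/-- At `u = 1` the conjugated matrix is the identity and `h_a` counts monomials. -/
theorem entryMoment_mul_choose (n a : ℕ) : entryMoment n a * ((n + a).choose a : ℂ) = 1 := by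
  rw [← completeSymm_one, ← integral_conj_diagonal_pow]
  simp

theorem entryMoment_succ (n a : ℕ) :
    entryMoment n (a + 1) * ((n : ℂ) + a + 1) = entryMoment n a * (a + 1) := by
  have h1 := entryMoment_mul_choose n a
  have h2 := entryMoment_mul_choose n (a + 1)
  have h3 : ((n + (a + 1)).choose (a + 1) : ℂ) * (a + 1) = (n + a + 1) * (n + a).choose a := by
    exact_mod_cast (Nat.add_one_mul_choose_eq (n + a) a).symm
  calc entryMoment n (a + 1) * ((n : ℂ) + a + 1)
      = entryMoment n (a + 1) * ((n : ℂ) + a + 1) * (entryMoment n a * ((n + a).choose a : ℂ)) := by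
        rw [h1, mul_one]
    _ = entryMoment n a * (entryMoment n (a + 1) * ((n + a + 1) * (n + a).choose a)) := by ring
    _ = entryMoment n a * (entryMoment n (a + 1) * ((n + (a + 1)).choose (a + 1) : ℂ)) * (a + 1) := by
        rw [← h3]; ring
    _ = _ := by rw [h2, mul_one]

/-! ### Class averages: trading `h_a` for a power of the corner entry. -/

/-- The average of `U₀₀ ^ a` over the conjugacy class of `U`. -/
noncomputable def conjAverage (n a : ℕ) (U : Matrix.unitaryGroup (Fin (n + 1)) ℂ) : ℂ :=
  ∫ V, (V * U * star V : Matrix.unitaryGroup (Fin (n + 1)) ℂ).1 0 0 ^ a ∂(haar (n + 1))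

/-- Right invariance in `V` absorbs the diagonalizing matrix `W`. -/
theorem conjAverage_eq {n : ℕ} (a : ℕ) {U W : Matrix.unitaryGroup (Fin (n + 1)) ℂ}
    {u : Fin (n + 1) → ℂ} (h : U.1 = W.1 * Matrix.diagonal u * star W.1) :
    conjAverage n a U = entryMoment n a * completeSymm a u := by
  rw [← integral_conj_diagonal_pow, conjAverage, ← integral_haar_mul_right W
    (fun V => ((V.1 * Matrix.diagonal u * star V.1) 0 0) ^ a)]
  refine integral_congr_ae (.of_forall fun V => ?_)
  simp only [Submonoid.coe_mul, Unitary.coe_star, h, star_mul, mul_assoc]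

theorem continuous_conj_entry {n : ℕ} : Continuous
    fun p : Matrix.unitaryGroup (Fin (n + 1)) ℂ × Matrix.unitaryGroup (Fin (n + 1)) ℂ =>
      (p.2 * p.1 * star p.2 : Matrix.unitaryGroup (Fin (n + 1)) ℂ).1 0 0 := by
  refine (continuous_entry 0 0).comp ?_
  have : Continuous fun p : Matrix.unitaryGroup (Fin (n + 1)) ℂ ×
      Matrix.unitaryGroup (Fin (n + 1)) ℂ => p.2 * p.1 * p.2⁻¹ := by fun_prop
  exact this

theorem continuous_conjAverage (n a : ℕ) : Continuous (conjAverage n a) := by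
  have : FirstCountableTopology (Matrix (Fin (n + 1)) (Fin (n + 1)) ℂ) :=
    inferInstanceAs (FirstCountableTopology (Fin (n + 1) → Fin (n + 1) → ℂ))
  have : FirstCountableTopology (Matrix.unitaryGroup (Fin (n + 1)) ℂ) :=
    TopologicalSpace.Subtype.firstCountableTopology _
  have h := continuous_parametric_integral_of_continuous (μ := haar (n + 1))
    (f := fun U V : Matrix.unitaryGroup (Fin (n + 1)) ℂ =>
      (V * U * star V : Matrix.unitaryGroup (Fin (n + 1)) ℂ).1 0 0 ^ a)
    (continuous_conj_entry.pow a) isCompact_univ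
  simp only [Measure.restrict_univ] at h
  exact h

/-- The substitution `U ↦ V U V*` does not affect the class function `X`; averaging over `V` and
exchanging the integrals turns the entry into its class average. -/
theorem integral_conj_entry_pow_mul {n : ℕ} (a : ℕ) {X : Matrix.unitaryGroup (Fin (n + 1)) ℂ → ℂ}
    (hX : Continuous X) (hXc : ∀ U V, X (V * U * star V) = X U) :
    ∫ U, starRingEnd ℂ (U.1 0 0) ^ a * X U ∂(haar (n + 1)) =
      ∫ U, starRingEnd ℂ (conjAverage n a U) * X U ∂(haar (n + 1)) := by
  have h1 : ∀ V : Matrix.unitaryGroup (Fin (n + 1)) ℂ,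
      ∫ U, starRingEnd ℂ (U.1 0 0) ^ a * X U ∂(haar (n + 1)) =
      ∫ U, starRingEnd ℂ ((V * U * star V : Matrix.unitaryGroup (Fin (n + 1)) ℂ).1 0 0) ^ a * X U
        ∂(haar (n + 1)) := by
    intro V
    rw [← integral_haar_mul_left V, ← integral_haar_mul_right (star V)]
    refine integral_congr_ae (.of_forall fun U => ?_)
    simp only [← mul_assoc, hXc]
  have h2 : ∫ U, starRingEnd ℂ (U.1 0 0) ^ a * X U ∂(haar (n + 1)) =
      ∫ V, ∫ U, starRingEnd ℂ ((V * U * star V : Matrix.unitaryGroup (Fin (n + 1)) ℂ).1 0 0) ^ a *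
        X U ∂(haar (n + 1)) ∂(haar (n + 1)) := by
    simp only [← h1]
    simp
  rw [h2, ← integral_haar_swap]
  · refine integral_congr_ae (.of_forall fun U => ?_)
    simp only []
    rw [integral_mul_const, conjAverage, ← integral_conj]
    simp only [map_pow]
  · exact ((Complex.continuous_conj.comp continuous_conj_entry).pow a).mul (hX.comp continuous_fst)

/-- The power sum of the eigenvalues of a matrix. -/
noncomputable def eigenPowerSum {N : ℕ} (R : ℕ) (M : Matrix (Fin N) (Fin N) ℂ) : ℂ :=
  (M.charpoly.roots.map fun z => z ^ R).sum

theorem elemSymm_eq_zero {N r : ℕ} (hr : N < r) (u : Fin N → ℂ) : elemSymm r u = 0 := by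
  rw [elemSymm, Finset.powersetCard_eq_empty.2 (by simpa using hr), Finset.sum_empty]

theorem minorSum_eq_elemSymm {N : ℕ} (r : ℕ) {U W : Matrix.unitaryGroup (Fin N) ℂ}
    {u : Fin N → ℂ} (h : U.1 = W.1 * Matrix.diagonal u * star W.1) :
    minorSum r U.1 = elemSymm r u := by
  rcases le_or_gt r N with hr | hr
  · rw [h, minorSum_unitary_conj, minorSum_diagonal hr]
  · rw [minorSum_eq_zero hr, elemSymm_eq_zero hr]

theorem conj_minorSum {N : ℕ} {c : ℕ} (hc : c ≤ N) (U : Matrix.unitaryGroup (Fin N) ℂ) :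
    starRingEnd ℂ (minorSum c U.1) = starRingEnd ℂ U.1.det * minorSum (N - c) U.1 := by
  obtain ⟨W, u, h⟩ := exists_unitary_diagonal U
  rw [minorSum_eq_elemSymm c h, minorSum_eq_elemSymm (N - c) h,
    conj_elemSymm (norm_eq_one_of_unitary_diagonal h) hc]
  rw [h, det_unitary_conj, Matrix.det_diagonal]

theorem eigenPowerSum_eq {n R : ℕ} (hR : 1 ≤ R) (U : Matrix.unitaryGroup (Fin (n + 1)) ℂ) :
    eigenPowerSum R U.1 = ∑ c ∈ Finset.range (R + 1), (-1) ^ (c + 1) * (c : ℂ) *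
      minorSum c U.1 * ((n + (R - c)).choose (R - c) * conjAverage n (R - c) U) := by
  obtain ⟨W, u, h⟩ := exists_unitary_diagonal U
  have h1 : eigenPowerSum R U.1 = ∑ i, u i ^ R := by
    rw [eigenPowerSum, h, roots_charpoly_unitary_diagonal, Multiset.map_map]
    rfl
  rw [h1, sum_pow_eq_sum_elemSymm_mul_completeSymm u hR]
  refine Finset.sum_congr rfl fun c _ => ?_
  rw [minorSum_eq_elemSymm c h, conjAverage_eq _ h]
  linear_combination -((-1) ^ (c + 1) * (c : ℂ) * elemSymm c u * completeSymm (R - c) u) *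
    entryMoment_mul_choose n (R - c)

theorem continuous_minorSum {N : ℕ} (r : ℕ) :
    Continuous fun U : Matrix.unitaryGroup (Fin N) ℂ => minorSum r U.1 :=
  continuous_finsetSum _ fun _ _ => continuous_const.mul
    (continuous_finsetProd _ fun _ _ => continuous_entry _ _)

theorem integral_conj_eigenPowerSum_mul {n R : ℕ} (hR : 1 ≤ R)
    {Y : Matrix.unitaryGroup (Fin (n + 1)) ℂ → ℂ}
    (hY : Continuous Y) (hYc : ∀ U V, Y (V * U * star V) = Y U) :
    ∫ U, starRingEnd ℂ (eigenPowerSum R U.1) * Y U ∂(haar (n + 1)) =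
      ∑ c ∈ (Finset.range (R + 1)).filter (· ≤ n + 1),
        (-1) ^ (c + 1) * (c : ℂ) * ((n + (R - c)).choose (R - c) *
          ∫ U, starRingEnd ℂ (U.1 0 0) ^ (R - c) * (starRingEnd ℂ U.1.det *
            (minorSum (n + 1 - c) U.1 * Y U)) ∂(haar (n + 1))) := by
  have h1 : ∀ U : Matrix.unitaryGroup (Fin (n + 1)) ℂ,
      starRingEnd ℂ (eigenPowerSum R U.1) * Y U =
      ∑ c ∈ (Finset.range (R + 1)).filter (· ≤ n + 1),
        ((-1) ^ (c + 1) * (c : ℂ) * (n + (R - c)).choose (R - c)) *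
          (starRingEnd ℂ (conjAverage n (R - c) U) * (starRingEnd ℂ U.1.det *
            (minorSum (n + 1 - c) U.1 * Y U))) := by
    intro U
    rw [eigenPowerSum_eq hR, map_sum, Finset.sum_mul, Finset.sum_filter]
    refine Finset.sum_congr rfl fun c _ => ?_
    -- For `c > n + 1` the subtraction `n + 1 - c` would truncate; these terms drop out because `e_c
    -- = 0`.
    split_ifs with hc
    · simp only [map_mul, map_pow, map_neg, map_one, map_natCast, conj_minorSum hc]
      ring
    · rw [minorSum_eq_zero (by omega)]
      simp
  have hc : ∀ c, Continuous fun U : Matrix.unitaryGroup (Fin (n + 1)) ℂ =>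
      starRingEnd ℂ U.1.det * (minorSum (n + 1 - c) U.1 * Y U) := fun c =>
    (Complex.continuous_conj.comp continuous_det_unitary).mul ((continuous_minorSum _).mul hY)
  simp only [h1]
  have hint : ∀ c : ℕ, Integrable (fun U : Matrix.unitaryGroup (Fin (n + 1)) ℂ =>
      ((-1) ^ (c + 1) * (c : ℂ) * (n + (R - c)).choose (R - c)) *
          (starRingEnd ℂ (conjAverage n (R - c) U) * (starRingEnd ℂ U.1.det *
            (minorSum (n + 1 - c) U.1 * Y U)))) (haar (n + 1)) := fun c =>
    (integrable_haar ((Complex.continuous_conj.comp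
      (continuous_conjAverage n (R - c))).mul (hc c))).const_mul _
  rw [integral_finsetSum _ fun c _ => hint c]
  refine Finset.sum_congr rfl fun c _ => ?_
  rw [integral_const_mul, integral_conj_entry_pow_mul _ (hc c)]
  · ring
  · intro U V
    simp only [hYc, Submonoid.coe_mul, Unitary.coe_star, minorSum_unitary_conj, det_unitary_conj]

/-! ### Pairing with `U₀₀ ^ a * det U`: symmetries and its two basic values. -/

/-- The pairing of a function on `U(n+1)` with `U₀₀ ^ a * det U` in `L²` of Haar measure. -/
noncomputable def cornerPairing (n a : ℕ) (F : Matrix.unitaryGroup (Fin (n + 1)) ℂ → ℂ) : ℂ :=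
  ∫ U, starRingEnd ℂ (U.1 0 0) ^ a * (starRingEnd ℂ U.1.det * F U) ∂(haar (n + 1))

theorem integrable_cornerPairing {n : ℕ} (a : ℕ) {F : Matrix.unitaryGroup (Fin (n + 1)) ℂ → ℂ}
    (hF : Continuous F) : Integrable
      (fun U => starRingEnd ℂ (U.1 0 0) ^ a * (starRingEnd ℂ U.1.det * F U)) (haar (n + 1)) :=
  integrable_haar (((Complex.continuous_conj.comp (continuous_entry 0 0)).pow a).mul
    ((Complex.continuous_conj.comp continuous_det_unitary).mul hF))

theorem cornerPairing_sum {n : ℕ} (a : ℕ) {κ : Type*} (s : Finset κ) (c : κ → ℂ)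
    (F : κ → Matrix.unitaryGroup (Fin (n + 1)) ℂ → ℂ) (hF : ∀ k ∈ s, Continuous (F k)) :
    cornerPairing n a (fun U => ∑ k ∈ s, c k * F k U) =
      ∑ k ∈ s, c k * cornerPairing n a (F k) := by
  have h : ∀ U : Matrix.unitaryGroup (Fin (n + 1)) ℂ,
      starRingEnd ℂ (U.1 0 0) ^ a * (starRingEnd ℂ U.1.det * ∑ k ∈ s, c k * F k U) =
      ∑ k ∈ s, c k * (starRingEnd ℂ (U.1 0 0) ^ a * (starRingEnd ℂ U.1.det * F k U)) := by
    intro U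
    simp only [Finset.mul_sum]
    exact Finset.sum_congr rfl fun k _ => by ring
  simp only [cornerPairing, h]
  rw [integral_finsetSum _ fun k hk => (integrable_cornerPairing a (hF k hk)).const_mul _]
  simp only [integral_const_mul]

/-- A phase on row `i ≠ 0` leaves `U₀₀` alone and multiplies the determinant by `z`, so only
functions of degree one in that row survive. -/
theorem cornerPairing_eq_zero_of_phase {n a m : ℕ} {i : Fin (n + 1)} (hi : i ≠ 0) (hm : m ≠ 1)
    {F : Matrix.unitaryGroup (Fin (n + 1)) ℂ → ℂ}
    (hF : ∀ (z : Circle) U, F (phase i z * U) = (z : ℂ) ^ m * F U) :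
    cornerPairing n a F = 0 := by
  obtain ⟨z, hz⟩ := exists_circle_pow_ne hm
  have hzz : (z : ℂ) * starRingEnd ℂ (z : ℂ) = 1 := by
    rw [Complex.mul_conj, Complex.normSq_eq_norm_sq, Circle.norm_coe]; simp
  refine integral_haar_eq_zero_of_mul_left (phase i z)
    (χ := (z : ℂ) ^ m * starRingEnd ℂ (z : ℂ)) ?_ ?_
  · intro h1
    apply hz
    linear_combination (z : ℂ) * h1 - (z : ℂ) ^ m * hzz
  · intro U
    rw [hF, phase_mul_apply, if_neg (Ne.symm hi), one_mul, Submonoid.coe_mul, Matrix.det_mul,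
      det_phase, map_mul]
    ring

theorem conj_sign {N : ℕ} (τ : Equiv.Perm (Fin N)) :
    starRingEnd ℂ ((Equiv.Perm.sign τ : ℤ) : ℂ) = ((Equiv.Perm.sign τ : ℤ) : ℂ) := by
  simp

theorem sign_mul_sign {N : ℕ} (τ : Equiv.Perm (Fin N)) :
    ((Equiv.Perm.sign τ : ℤ) : ℂ) * ((Equiv.Perm.sign τ : ℤ) : ℂ) = 1 := by
  exact_mod_cast Int.units_coe_mul_self (Equiv.Perm.sign τ)

theorem cornerPairing_mul_permUnitary {n a : ℕ} {τ : Equiv.Perm (Fin (n + 1))} (hτ : τ 0 = 0)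
    (F : Matrix.unitaryGroup (Fin (n + 1)) ℂ → ℂ) :
    cornerPairing n a F =
      ((Equiv.Perm.sign τ : ℤ) : ℂ) * cornerPairing n a (fun U => F (U * permUnitary τ)) := by
  rw [cornerPairing, ← integral_haar_mul_right (permUnitary τ), cornerPairing, ← integral_const_mul]
  refine integral_congr_ae (.of_forall fun U => ?_)
  have h0 : τ.symm 0 = 0 := by rw [Equiv.symm_apply_eq, hτ]
  simp only [mul_permUnitary_apply, Submonoid.coe_mul, Matrix.det_mul, det_permUnitary, map_mul,
    conj_sign, h0]
  ring

theorem cornerPairing_permUnitary_mul {n a : ℕ} {τ : Equiv.Perm (Fin (n + 1))} (hτ : τ 0 = 0)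
    (F : Matrix.unitaryGroup (Fin (n + 1)) ℂ → ℂ) :
    cornerPairing n a F =
      ((Equiv.Perm.sign τ : ℤ) : ℂ) * cornerPairing n a (fun U => F (permUnitary τ * U)) := by
  rw [cornerPairing, ← integral_haar_mul_left (permUnitary τ), cornerPairing, ← integral_const_mul]
  refine integral_congr_ae (.of_forall fun U => ?_)
  simp only [permUnitary_mul_apply, Submonoid.coe_mul, Matrix.det_mul, det_permUnitary, map_mul,
    conj_sign, hτ]
  ring

/-- The monomial `U₀₀ ^ a * ∏ᵢ U i (τ i)` paired with `U₀₀ ^ a * det U`, up to the sign of `τ`. -/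
noncomputable def permPairing (n a : ℕ) (τ : Equiv.Perm (Fin (n + 1))) : ℂ :=
  ((Equiv.Perm.sign τ : ℤ) : ℂ) * cornerPairing n a (fun U => U.1 0 0 ^ a * ∏ i, U.1 i (τ i))

/-- The sign built into `permPairing` cancels the one coming from the determinant. With
`permPairing_mul_right`, the value depends only on the double coset of `τ` modulo the stabilizer of
`0`. -/
theorem permPairing_mul_left {n a : ℕ} {π : Equiv.Perm (Fin (n + 1))} (hπ : π 0 = 0)
    (τ : Equiv.Perm (Fin (n + 1))) : permPairing n a (π * τ) = permPairing n a τ := by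
  have h0 : π.symm 0 = 0 := by rw [Equiv.symm_apply_eq, hπ]
  rw [permPairing, permPairing, cornerPairing_mul_permUnitary hπ
    (fun U => U.1 0 0 ^ a * ∏ i, U.1 i ((π * τ) i))]
  simp only [mul_permUnitary_apply, h0, Equiv.Perm.mul_apply, Equiv.symm_apply_apply]
  simp only [map_mul, Units.val_mul, Int.cast_mul]
  linear_combination (((Equiv.Perm.sign τ : ℤ) : ℂ) * cornerPairing n a
    (fun U => U.1 0 0 ^ a * ∏ i, U.1 i (τ i))) * sign_mul_sign π

theorem permPairing_mul_right {n a : ℕ} {π : Equiv.Perm (Fin (n + 1))} (hπ : π 0 = 0)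
    (τ : Equiv.Perm (Fin (n + 1))) : permPairing n a (τ * π) = permPairing n a τ := by
  rw [permPairing, permPairing, cornerPairing_permUnitary_mul hπ
    (fun U => U.1 0 0 ^ a * ∏ i, U.1 i ((τ * π) i))]
  have h : ∀ U : Matrix.unitaryGroup (Fin (n + 1)) ℂ,
      ∏ i, U.1 (π i) (τ (π i)) = ∏ i, U.1 i (τ i) := fun U =>
    Equiv.prod_comp π fun i => U.1 i (τ i)
  simp only [permUnitary_mul_apply, hπ, Equiv.Perm.mul_apply, h]
  simp only [map_mul, Units.val_mul, Int.cast_mul]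
  linear_combination (((Equiv.Perm.sign τ : ℤ) : ℂ) * cornerPairing n a
    (fun U => U.1 0 0 ^ a * ∏ i, U.1 i (τ i))) * sign_mul_sign π

theorem permPairing_of_fix {n a : ℕ} {τ : Equiv.Perm (Fin (n + 1))} (hτ : τ 0 = 0) :
    permPairing n a τ = permPairing n a 1 := by
  rw [← permPairing_mul_left hτ 1, mul_one]

/-- The permutations moving `0` form a single double coset of the stabilizer: `ρ` fixes `0` and
sends `τ'⁻¹ 0` to `τ⁻¹ 0`, so `τ ρ τ'⁻¹` fixes `0`. -/
theorem permPairing_of_not_fix {n a : ℕ} {τ τ' : Equiv.Perm (Fin (n + 1))} (hτ : τ 0 ≠ 0)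
    (hτ' : τ' 0 ≠ 0) : permPairing n a τ = permPairing n a τ' := by
  have h1 : τ⁻¹ 0 ≠ 0 := fun h => hτ (by rw [Equiv.Perm.inv_eq_iff_eq] at h; exact h.symm)
  have h1' : τ'⁻¹ 0 ≠ 0 := fun h => hτ' (by rw [Equiv.Perm.inv_eq_iff_eq] at h; exact h.symm)
  set ρ := Equiv.swap (τ⁻¹ 0) (τ'⁻¹ 0) with hρ
  have hρ0 : ρ 0 = 0 := Equiv.swap_apply_of_ne_of_ne (Ne.symm h1) (Ne.symm h1')
  have h2 : (τ * ρ * τ'⁻¹) 0 = 0 := by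
    simp [hρ]
  calc permPairing n a τ = permPairing n a (τ * ρ) := (permPairing_mul_right hρ0 τ).symm
    _ = permPairing n a (τ * ρ * τ'⁻¹ * τ') := by rw [inv_mul_cancel_right]
    _ = permPairing n a τ' := permPairing_mul_left h2 τ'

theorem card_perm_supported {N : ℕ} (S : Finset (Fin N)) :
    (Finset.univ.filter fun σ : Equiv.Perm (Fin N) => ∀ i ∉ S, σ i = i).card = S.card.factorial := by
  have h := Fintype.card_congr (Equiv.Perm.subtypeEquivSubtypePerm (· ∈ S))
  rw [Fintype.card_perm, Fintype.card_coe, Fintype.card_subtype] at h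
  exact h.symm

theorem card_perm_fix_zero (n : ℕ) :
    (Finset.univ.filter fun σ : Equiv.Perm (Fin (n + 1)) => σ 0 = 0).card = n.factorial := by
  have h := card_perm_supported (Finset.univ.erase (0 : Fin (n + 1)))
  simpa using h

theorem continuous_permMonomial {n : ℕ} (a : ℕ) (τ : Equiv.Perm (Fin (n + 1))) :
    Continuous fun U : Matrix.unitaryGroup (Fin (n + 1)) ℂ => U.1 0 0 ^ a * ∏ i, U.1 i (τ i) :=
  ((continuous_entry 0 0).pow a).mul (continuous_finsetProd _ fun _ _ => continuous_entry _ _)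

theorem conj_det_mul_det {N : ℕ} (U : Matrix.unitaryGroup (Fin N) ℂ) :
    starRingEnd ℂ U.1.det * U.1.det = 1 := by
  have h := congrArg Matrix.det ((Matrix.mem_unitaryGroup_iff').1 U.2)
  rwa [Matrix.det_mul, Matrix.star_eq_conjTranspose, Matrix.det_conjTranspose, Matrix.det_one] at h

/-- The signed monomials add up to `U₀₀ ^ a * det U`, paired here with itself; the determinant has
modulus one. -/
theorem sum_permPairing (n a : ℕ) : ∑ τ, permPairing n a τ = entryMoment n a := by
  simp only [permPairing]
  rw [← cornerPairing_sum _ _ _ _ fun τ _ => continuous_permMonomial a τ, cornerPairing, entryMoment]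
  refine integral_congr_ae (.of_forall fun U => ?_)
  have h : ∑ τ : Equiv.Perm (Fin (n + 1)), ((Equiv.Perm.sign τ : ℤ) : ℂ) *
      (U.1 0 0 ^ a * ∏ i, U.1 i (τ i)) = U.1 0 0 ^ a * U.1.det := by
    rw [← Matrix.det_transpose, Matrix.det_apply', Finset.mul_sum]
    exact Finset.sum_congr rfl fun τ _ => by simp only [Matrix.transpose_apply]; ring
  simp only [h]
  linear_combination (U.1 0 0 ^ a * starRingEnd ℂ (U.1 0 0) ^ a) * conj_det_mul_det U

theorem adjugate_unitary {N : ℕ} (U : Matrix.unitaryGroup (Fin N) ℂ) :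
    U.1.adjugate = U.1.det • star U.1 := by
  have h := Matrix.adjugate_mul U.1
  have h2 := congrArg (· * star U.1) h
  simpa [mul_assoc] using h2

theorem sum_sign_mul_prod_fix_zero {n : ℕ} (M : Matrix (Fin (n + 1)) (Fin (n + 1)) ℂ) :
    ∑ τ ∈ Finset.univ.filter (fun σ : Equiv.Perm (Fin (n + 1)) => σ 0 = 0),
      ((Equiv.Perm.sign τ : ℤ) : ℂ) * ∏ i, M i (τ i) = M 0 0 * M.adjugate 0 0 := by
  rw [Matrix.adjugate_apply, ← Matrix.det_transpose, Matrix.det_apply', Finset.sum_filter,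
    Finset.mul_sum]
  refine Finset.sum_congr rfl fun τ _ => ?_
  rw [Fin.prod_univ_succ, Fin.prod_univ_succ]
  split_ifs with h
  · simp [h]; ring
  · simp [h]

/-- The terms fixing `0` add up to `U₀₀ ^ (a+1)` times the corner cofactor, which is `det U * conj
U₀₀` for unitary `U`. This raises the moment by one. -/
theorem sum_permPairing_fix_zero (n a : ℕ) :
    ∑ τ ∈ Finset.univ.filter (fun σ : Equiv.Perm (Fin (n + 1)) => σ 0 = 0), permPairing n a τ =
      entryMoment n (a + 1) := by
  simp only [permPairing]
  rw [← cornerPairing_sum _ _ _ _ fun τ _ => continuous_permMonomial a τ, cornerPairing, entryMoment]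
  refine integral_congr_ae (.of_forall fun U => ?_)
  have h : ∑ τ ∈ Finset.univ.filter (fun σ : Equiv.Perm (Fin (n + 1)) => σ 0 = 0),
      ((Equiv.Perm.sign τ : ℤ) : ℂ) * (U.1 0 0 ^ a * ∏ i, U.1 i (τ i)) =
      U.1 0 0 ^ a * (U.1 0 0 * (U.1.det * starRingEnd ℂ (U.1 0 0))) := by
    have := sum_sign_mul_prod_fix_zero U.1
    rw [adjugate_unitary, Matrix.smul_apply, Matrix.star_apply, smul_eq_mul, RCLike.star_def] at this
    rw [← this, Finset.mul_sum]
    exact Finset.sum_congr rfl fun τ _ => by ring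
  simp only [h]
  linear_combination (U.1 0 0 ^ (a + 1) * starRingEnd ℂ (U.1 0 0) ^ (a + 1)) * conj_det_mul_det U

theorem factorial_mul_permPairing_one (n a : ℕ) :
    (n.factorial : ℂ) * permPairing n a 1 = entryMoment n (a + 1) := by
  rw [← sum_permPairing_fix_zero, Finset.sum_congr rfl fun τ hτ =>
    permPairing_of_fix (Finset.mem_filter.1 hτ).2, Finset.sum_const, card_perm_fix_zero,
    nsmul_eq_mul]

/-- The `n · n!` permutations moving `0` share `entryMoment n a - entryMoment n (a + 1)` equally;
`entryMoment_succ` rewrites that difference. -/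
theorem factorial_mul_permPairing {n : ℕ} (hn : 1 ≤ n) (a : ℕ) {τ : Equiv.Perm (Fin (n + 1))}
    (hτ : τ 0 ≠ 0) :
    (n.factorial : ℂ) * permPairing n a τ * (a + 1) = entryMoment n (a + 1) := by
  have h := Finset.sum_filter_add_sum_filter_not Finset.univ
    (fun σ : Equiv.Perm (Fin (n + 1)) => σ 0 = 0) (permPairing n a)
  rw [sum_permPairing, sum_permPairing_fix_zero, Finset.sum_congr rfl fun τ' hτ' =>
    permPairing_of_not_fix (Finset.mem_filter.1 hτ').2 hτ, Finset.sum_const, nsmul_eq_mul] at h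
  have hcard := Finset.card_filter_add_card_filter_not (s := Finset.univ)
    (fun σ : Equiv.Perm (Fin (n + 1)) => σ 0 = 0)
  rw [card_perm_fix_zero, Finset.card_univ, Fintype.card_perm, Fintype.card_fin,
    Nat.factorial_succ] at hcard
  have hc : ((Finset.univ.filter fun σ : Equiv.Perm (Fin (n + 1)) => ¬ σ 0 = 0).card : ℂ) =
      n * n.factorial := by
    have : (Finset.univ.filter fun σ : Equiv.Perm (Fin (n + 1)) => ¬ σ 0 = 0).card =
      n * n.factorial := by linarith
    exact_mod_cast this
  rw [hc] at h
  have h2 := entryMoment_succ n a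
  have hn0 : (n : ℂ) ≠ 0 := by exact_mod_cast (by omega : n ≠ 0)
  apply mul_left_cancel₀ hn0
  linear_combination (a + 1) * h - h2

/-! ### Reduction of products of partial permutations. -/

/-- The monomial in the entries of `M` given by a family of partial permutations. -/
noncomputable def partialPermMonomial {ι : Type*} [Fintype ι] {N : ℕ} (S : ι → Finset (Fin N))
    (σ : ι → Equiv.Perm (Fin N)) (M : Matrix (Fin N) (Fin N) ℂ) : ℂ :=
  ∏ j, ∏ i ∈ S j, M i (σ j i)

theorem continuous_partialPermMonomial {ι : Type*} [Fintype ι] {N : ℕ} (S : ι → Finset (Fin N))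
    (σ : ι → Equiv.Perm (Fin N)) :
    Continuous fun U : Matrix.unitaryGroup (Fin N) ℂ => partialPermMonomial S σ U.1 :=
  continuous_finsetProd _ fun _ _ => continuous_finsetProd _ fun _ _ => continuous_entry _ _

theorem prod_prod_mem_comm {ι : Type*} [Fintype ι] [DecidableEq ι] {N : ℕ} (S : ι → Finset (Fin N))
    (f : ι → Fin N → ℂ) :
    ∏ j, ∏ i ∈ S j, f j i = ∏ i, ∏ j ∈ Finset.univ.filter (fun j => i ∈ S j), f j i :=
  Finset.prod_comm' (by simp)

/-- Every nonzero index lies in exactly one of the sets `S j`. -/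
def IsCovering {ι : Type*} [Fintype ι] {n : ℕ} (S : ι → Finset (Fin (n + 1))) : Prop :=
  ∀ i, i ≠ 0 → (Finset.univ.filter fun j => i ∈ S j).card = 1

theorem IsCovering.eq {ι : Type*} [Fintype ι] {n : ℕ} {S : ι → Finset (Fin (n + 1))}
    (h : IsCovering S) {i : Fin (n + 1)} (hi : i ≠ 0) {j j' : ι} (hj : i ∈ S j) (hj' : i ∈ S j') :
    j = j' := by
  obtain ⟨l, hl⟩ := Finset.card_eq_one.1 (h i hi)
  have h1 : j ∈ Finset.univ.filter fun j => i ∈ S j := by simpa using hj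
  have h2 : j' ∈ Finset.univ.filter fun j => i ∈ S j := by simpa using hj'
  rw [hl, Finset.mem_singleton] at h1 h2
  rw [h1, h2]

/-- The degree of the monomial in row `i` is the number of sets containing `i`, so a failure of
covering is a failure of degree one in some row `i ≠ 0`. -/
theorem cornerPairing_partialPermMonomial_eq_zero {ι : Type*} [Fintype ι] [DecidableEq ι] {n a : ℕ}
    {S : ι → Finset (Fin (n + 1))} (σ : ι → Equiv.Perm (Fin (n + 1))) (h : ¬ IsCovering S) :
    cornerPairing n a (fun U => partialPermMonomial S σ U.1) = 0 := by
  unfold IsCovering at h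
  push Not at h
  obtain ⟨i, hi, hm⟩ := h
  refine cornerPairing_eq_zero_of_phase hi hm fun z U => ?_
  simp only [partialPermMonomial, phase_mul_apply, Finset.prod_mul_distrib]
  congr 1
  rw [prod_prod_mem_comm S (fun _ k => if k = i then (z : ℂ) else 1)]
  simp only [Finset.prod_const, ite_pow, one_pow, Finset.prod_ite_eq', Finset.mem_univ, if_true]

theorem mem_of_supported {N : ℕ} {S : Finset (Fin N)} {σ : Equiv.Perm (Fin N)}
    (h : ∀ i ∉ S, σ i = i) {i : Fin N} (hi : i ∈ S) : σ i ∈ S := by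
  by_contra h'
  have := σ.injective (h _ h')
  rw [this] at h'
  exact h' hi

/-- A column permutation undoes `σ j`. The other factors do not notice: a nonzero column lies in
only one of the sets, and column `0` is fixed. -/
theorem cornerPairing_update_one {ι : Type*} [Fintype ι] [DecidableEq ι] {n a : ℕ}
    {S : ι → Finset (Fin (n + 1))} (hS : IsCovering S) {σ : ι → Equiv.Perm (Fin (n + 1))}
    (hσ : ∀ j, ∀ i ∉ S j, σ j i = i) {j : ι} (hj : σ j 0 = 0) :
    cornerPairing n a (fun U => partialPermMonomial S σ U.1) =
      ((Equiv.Perm.sign (σ j) : ℤ) : ℂ) *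
        cornerPairing n a (fun U => partialPermMonomial S (Function.update σ j 1) U.1) := by
  rw [cornerPairing_mul_permUnitary hj]
  congr 2
  funext U
  simp only [partialPermMonomial, mul_permUnitary_apply]
  refine Finset.prod_congr rfl fun l _ => Finset.prod_congr rfl fun i hi => ?_
  rcases eq_or_ne l j with rfl | hl
  · simp
  · rw [Function.update_of_ne hl]
    suffices h : (σ j).symm (σ l i) = σ l i by rw [h]
    rw [Equiv.symm_apply_eq]
    by_cases h0 : σ l i = 0
    · rw [h0, hj]
    · by_contra h1
      have h2 : σ l i ∈ S j := by
        by_contra h3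
        exact h1 (hσ j _ h3).symm
      exact hl (hS.eq h0 (mem_of_supported (hσ l) hi) h2)

theorem cornerPairing_eq_prod_sign_mul {ι : Type*} [Fintype ι] [DecidableEq ι] {n a : ℕ}
    {S : ι → Finset (Fin (n + 1))} (hS : IsCovering S) {σ : ι → Equiv.Perm (Fin (n + 1))}
    (hσ : ∀ j, ∀ i ∉ S j, σ j i = i) (T : Finset ι) (hT : ∀ j ∈ T, σ j 0 = 0) :
    cornerPairing n a (fun U => partialPermMonomial S σ U.1) =
      (∏ j ∈ T, ((Equiv.Perm.sign (σ j) : ℤ) : ℂ)) *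
        cornerPairing n a (fun U => partialPermMonomial S (fun j => if j ∈ T then 1 else σ j) U.1) := by
  induction T using Finset.induction_on with
  | empty => simp
  | insert j T hjT ih =>
    rw [ih fun l hl => hT l (Finset.mem_insert_of_mem hl), Finset.prod_insert hjT]
    have h1 : ∀ l, ∀ i ∉ S l, (if l ∈ T then (1 : Equiv.Perm (Fin (n + 1))) else σ l) i = i := by
      intro l i hi
      split_ifs
      · rfl
      · exact hσ l i hi
    have h2 : (if j ∈ T then (1 : Equiv.Perm (Fin (n + 1))) else σ j) 0 = 0 := by
      rw [if_neg hjT]; exact hT j (Finset.mem_insert_self _ _)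
    rw [cornerPairing_update_one hS h1 h2, if_neg hjT]
    have h3 : Function.update (fun l => if l ∈ T then (1 : Equiv.Perm (Fin (n + 1))) else σ l) j 1 =
        fun l => if l ∈ insert j T then 1 else σ l := by
      funext l
      rcases eq_or_ne l j with rfl | hl
      · simp
      · simp [hl]
    rw [h3]
    ring

/-- Two partial permutations moving `0` make the pairing vanish. -/
theorem cornerPairing_eq_zero_of_two_moved {ι : Type*} [Fintype ι] [DecidableEq ι] {n a : ℕ}
    {S : ι → Finset (Fin (n + 1))} (hS : IsCovering S) {σ : ι → Equiv.Perm (Fin (n + 1))}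
    (hσ : ∀ j, ∀ i ∉ S j, σ j i = i) {l l' : ι} (hll : l ≠ l') (hl : σ l 0 ≠ 0) (hl' : σ l' 0 ≠ 0) :
    cornerPairing n a (fun U => partialPermMonomial S σ U.1) = 0 := by
  have h0 : 0 ∈ S l := by by_contra h; exact hl (hσ l 0 h)
  have h0' : 0 ∈ S l' := by by_contra h; exact hl' (hσ l' 0 h)
  have hc := mem_of_supported (hσ l) h0
  have hc' := mem_of_supported (hσ l') h0'
  have hcc : σ l 0 ≠ σ l' 0 := fun h => hll (hS.eq hl hc (h ▸ hc'))
  -- The columns `σ l 0` and `σ l' 0` each occur once in the monomial, both in row `0`. Swapping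
  -- them preserves it but reverses the sign of the determinant.
  have key : ∀ U : Matrix.unitaryGroup (Fin (n + 1)) ℂ,
      partialPermMonomial S σ (U * permUnitary (Equiv.swap (σ l 0) (σ l' 0)) :
        Matrix.unitaryGroup (Fin (n + 1)) ℂ).1 = partialPermMonomial S σ U.1 := by
    intro U
    simp only [partialPermMonomial, mul_permUnitary_apply, Equiv.symm_swap]
    rw [prod_prod_mem_comm S, prod_prod_mem_comm S]
    refine Finset.prod_congr rfl fun i _ => ?_
    rcases eq_or_ne i 0 with rfl | hi
    · refine Finset.prod_bij' (fun j _ => Equiv.swap l l' j) (fun j _ => Equiv.swap l l' j)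
        ?_ ?_ ?_ ?_ ?_
      · intro j hj
        simp only [Finset.mem_filter, Finset.mem_univ, true_and] at hj ⊢
        rcases eq_or_ne j l with rfl | h1
        · simpa using h0'
        rcases eq_or_ne j l' with rfl | h2
        · simpa using h0
        rwa [Equiv.swap_apply_of_ne_of_ne h1 h2]
      · intro j hj
        simp only [Finset.mem_filter, Finset.mem_univ, true_and] at hj ⊢
        rcases eq_or_ne j l with rfl | h1
        · simpa using h0'
        rcases eq_or_ne j l' with rfl | h2
        · simpa using h0
        rwa [Equiv.swap_apply_of_ne_of_ne h1 h2]
      · intro j _; simp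
      · intro j _; simp
      · intro j hj
        simp only [Finset.mem_filter, Finset.mem_univ, true_and] at hj
        rcases eq_or_ne j l with rfl | h1
        · simp
        rcases eq_or_ne j l' with rfl | h2
        · simp
        rw [Equiv.swap_apply_of_ne_of_ne h1 h2]
        have hmem := mem_of_supported (hσ j) hj
        rw [Equiv.swap_apply_of_ne_of_ne]
        · intro h; exact h1 (hS.eq hl (h ▸ hmem) hc)
        · intro h; exact h2 (hS.eq hl' (h ▸ hmem) hc')
    · refine Finset.prod_congr rfl fun j hj => ?_
      simp only [Finset.mem_filter, Finset.mem_univ, true_and] at hj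
      have hmem := mem_of_supported (hσ j) hj
      rw [Equiv.swap_apply_of_ne_of_ne]
      · intro h
        have := hS.eq hl (h ▸ hmem) hc
        subst this
        exact hi ((σ j).injective h)
      · intro h
        have := hS.eq hl' (h ▸ hmem) hc'
        subst this
        exact hi ((σ j).injective h)
  have h := cornerPairing_mul_permUnitary (a := a)
    (Equiv.swap_apply_of_ne_of_ne (Ne.symm hl) (Ne.symm hl'))
    (fun U : Matrix.unitaryGroup (Fin (n + 1)) ℂ => partialPermMonomial S σ U.1)
  simp only [key, Equiv.Perm.sign_swap hcc] at h
  push_cast at h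
  linear_combination h / 2

theorem partialPermMonomial_one {ι : Type*} [Fintype ι] [DecidableEq ι] {n a : ℕ}
    {S : ι → Finset (Fin (n + 1))} (hS : IsCovering S)
    (h0 : (Finset.univ.filter fun j => 0 ∈ S j).card = a + 1)
    (M : Matrix (Fin (n + 1)) (Fin (n + 1)) ℂ) :
    partialPermMonomial S (fun _ => 1) M =
      M 0 0 ^ a * ∏ i, M i ((1 : Equiv.Perm (Fin (n + 1))) i) := by
  rw [partialPermMonomial, prod_prod_mem_comm S]
  simp only [Finset.prod_const, Equiv.Perm.coe_one, id]
  rw [Fin.prod_univ_succ, Fin.prod_univ_succ, h0, ← mul_assoc, ← pow_succ]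
  congr 1
  exact Finset.prod_congr rfl fun i _ => by rw [hS _ (Fin.succ_ne_zero i), pow_one]

theorem partialPermMonomial_single {ι : Type*} [Fintype ι] [DecidableEq ι] {n a : ℕ}
    {S : ι → Finset (Fin (n + 1))} (hS : IsCovering S)
    (h0 : (Finset.univ.filter fun j => 0 ∈ S j).card = a + 1) {l : ι}
    {τ : Equiv.Perm (Fin (n + 1))} (hτ : ∀ i ∉ S l, τ i = i) (hl : 0 ∈ S l)
    (M : Matrix (Fin (n + 1)) (Fin (n + 1)) ℂ) :
    partialPermMonomial S (fun j => if j = l then τ else 1) M = M 0 0 ^ a * ∏ i, M i (τ i) := by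
  rw [partialPermMonomial, prod_prod_mem_comm S, Fin.prod_univ_succ, Fin.prod_univ_succ, ← mul_assoc]
  congr 1
  · have hmem : l ∈ Finset.univ.filter fun j => 0 ∈ S j := by simpa using hl
    rw [← Finset.mul_prod_erase _ _ hmem, if_pos rfl, mul_comm, Finset.prod_congr rfl fun j hj => by
      rw [if_neg (Finset.ne_of_mem_erase hj)], Finset.prod_const, Finset.card_erase_of_mem hmem, h0]
    simp
  · refine Finset.prod_congr rfl fun i _ => ?_
    obtain ⟨j, hj⟩ := Finset.card_eq_one.1 (hS _ (Fin.succ_ne_zero i))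
    rw [hj, Finset.prod_singleton]
    have hji : i.succ ∈ S j := by
      have : j ∈ Finset.univ.filter fun j => i.succ ∈ S j := by rw [hj]; simp
      simpa using this
    split_ifs with h
    · rfl
    · rw [hτ _ fun h' => h (hS.eq (Fin.succ_ne_zero i) hji h')]
      rfl

/-- The cases are: no `σ j` moves `0`, exactly one does, or several do (value zero). Writing them
with products of indicators over `j` lets the sum over `σ` factorize. -/
theorem prod_sign_mul_cornerPairing {ι : Type*} [Fintype ι] [DecidableEq ι] {n a : ℕ}
    {S : ι → Finset (Fin (n + 1))} (hS : IsCovering S)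
    (h0 : (Finset.univ.filter fun j => 0 ∈ S j).card = a + 1)
    {σ : ι → Equiv.Perm (Fin (n + 1))} (hσ : ∀ j, ∀ i ∉ S j, σ j i = i) {b : ℂ}
    (hb : ∀ τ : Equiv.Perm (Fin (n + 1)), τ 0 ≠ 0 → permPairing n a τ = b) :
    (∏ j, ((Equiv.Perm.sign (σ j) : ℤ) : ℂ)) *
        cornerPairing n a (fun U => partialPermMonomial S σ U.1) =
      permPairing n a 1 * (∏ j, if σ j 0 = 0 then 1 else 0) +
        b * ∑ l, ∏ j, if j = l then (if σ j 0 = 0 then 0 else 1) else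
          (if σ j 0 = 0 then 1 else 0) := by
  have hsq : ∀ T : Finset ι, (∏ j ∈ T, ((Equiv.Perm.sign (σ j) : ℤ) : ℂ)) *
      (∏ j ∈ T, ((Equiv.Perm.sign (σ j) : ℤ) : ℂ)) = 1 := by
    intro T
    rw [← Finset.prod_mul_distrib]
    exact Finset.prod_eq_one fun j _ => sign_mul_sign _
  by_cases h1 : ∀ j, σ j 0 = 0
  · rw [cornerPairing_eq_prod_sign_mul hS hσ Finset.univ fun j _ => h1 j, ← mul_assoc, hsq, one_mul]
    simp only [Finset.mem_univ, if_true, partialPermMonomial_one hS h0, h1]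
    rw [Finset.sum_eq_zero fun l _ => Finset.prod_eq_zero (Finset.mem_univ l) (by simp)]
    simp [permPairing]
  · push Not at h1
    obtain ⟨l, hl⟩ := h1
    have hz : ∏ j, (if σ j 0 = 0 then (1 : ℂ) else 0) = 0 :=
      Finset.prod_eq_zero (Finset.mem_univ l) (if_neg hl)
    rw [hz, mul_zero, zero_add]
    by_cases h2 : ∃ l', l' ≠ l ∧ σ l' 0 ≠ 0
    · obtain ⟨l', hll, hl'⟩ := h2
      rw [cornerPairing_eq_zero_of_two_moved hS hσ hll.symm hl hl', mul_zero,
        Finset.sum_eq_zero, mul_zero]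
      intro m _
      rcases eq_or_ne m l with rfl | hm
      · exact Finset.prod_eq_zero (Finset.mem_univ l') (by rw [if_neg hll, if_neg hl'])
      · exact Finset.prod_eq_zero (Finset.mem_univ l) (by rw [if_neg hm.symm, if_neg hl])
    · push Not at h2
      have hmem : 0 ∈ S l := by by_contra h; exact hl (hσ l 0 h)
      rw [Finset.sum_eq_single l]
      · have hone : ∏ j, (if j = l then (if σ j 0 = 0 then (0 : ℂ) else 1) else
            (if σ j 0 = 0 then 1 else 0)) = 1 := by
          refine Finset.prod_eq_one fun j _ => ?_
          by_cases hj : j = l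
          · subst hj; simp [hl]
          · simp [hj, h2 j hj]
        rw [hone, mul_one, cornerPairing_eq_prod_sign_mul hS hσ (Finset.univ.erase l) fun j hj =>
          h2 j (Finset.ne_of_mem_erase hj), ← Finset.mul_prod_erase _ _ (Finset.mem_univ l)]
        have h3 : (fun j => if j ∈ Finset.univ.erase l then (1 : Equiv.Perm (Fin (n + 1))) else σ j) =
            fun j => if j = l then σ l else 1 := by
          funext j
          by_cases hj : j = l
          · subst hj; simp
          · simp [hj]
        rw [h3, ← hb (σ l) hl, permPairing]
        simp only [partialPermMonomial_single hS h0 (hσ l) hmem]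
        linear_combination (((Equiv.Perm.sign (σ l) : ℤ) : ℂ) * cornerPairing n a
          (fun U => U.1 0 0 ^ a * ∏ i, U.1 i (σ l i))) * hsq (Finset.univ.erase l)
      · intro m _ hm
        exact Finset.prod_eq_zero (Finset.mem_univ l) (by rw [if_neg hm.symm, if_neg hl])
      · intro h; exact absurd (Finset.mem_univ l) h

/-! ### Counting coverings and supported permutations. -/

/-- The cardinality of the fibre of `κ` over `j`. -/
def fiberCard {ι : Type*} [DecidableEq ι] {n : ℕ} (κ : Fin n → ι) (j : ι) : ℕ :=
  (Finset.univ.filter fun i => κ i = j).card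

/-- The number of maps with prescribed fibre cardinalities is a multinomial coefficient. -/
theorem card_filter_fiberCard {ι : Type*} [Fintype ι] [DecidableEq ι] {n : ℕ} (s : ι → ℕ)
    (hs : ∑ j, s j = n) :
    (Finset.univ.filter fun κ : Fin n → ι => ∀ j, fiberCard κ j = s j).card =
      Nat.multinomial Finset.univ s := by
  -- Compare coefficients in two expansions of `(Σ X_j)^n`: over words `κ`, and by the multinomial
  -- theorem.
  have h1 : (∑ j, (MvPolynomial.X j : MvPolynomial ι ℕ)) ^ n =
      ∑ κ : Fin n → ι, ∏ i, MvPolynomial.X (κ i) := by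
    rw [Finset.sum_pow', Fintype.piFinset_univ]
  have h2 : ∀ κ : Fin n → ι, ∏ i, (MvPolynomial.X (κ i) : MvPolynomial ι ℕ) =
      MvPolynomial.monomial (Finsupp.equivFunOnFinite.symm (fiberCard κ)) 1 := by
    intro κ
    rw [MvPolynomial.monomial_eq, map_one, one_mul, Finsupp.prod_fintype _ _ (by simp)]
    rw [← Finset.prod_fiberwise Finset.univ κ]
    refine Finset.prod_congr rfl fun j _ => ?_
    rw [Finset.prod_congr rfl fun i hi => by rw [(Finset.mem_filter.1 hi).2], Finset.prod_const]
    rfl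
  have h3 : ∀ t : ι → ℕ, ∏ j, (MvPolynomial.X j : MvPolynomial ι ℕ) ^ t j =
      MvPolynomial.monomial (Finsupp.equivFunOnFinite.symm t) 1 := by
    intro t
    rw [MvPolynomial.monomial_eq, map_one, one_mul, Finsupp.prod_fintype _ _ (by simp)]
    rfl
  rw [Finset.sum_pow_eq_sum_piAntidiag] at h1
  have h4 := congrArg (MvPolynomial.coeff (Finsupp.equivFunOnFinite.symm s)) h1
  simp only [h2, h3, MvPolynomial.coeff_sum, MvPolynomial.coeff_monomial,
    EmbeddingLike.apply_eq_iff_eq, ← nsmul_eq_mul, MvPolynomial.coeff_smul] at h4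
  simp only [smul_eq_mul, mul_ite, mul_one, mul_zero, Finset.sum_ite_eq', Finset.mem_piAntidiag,
    hs, Finset.mem_univ, implies_true, and_true, if_true] at h4
  rw [h4, Finset.card_filter]
  exact Finset.sum_congr rfl fun κ _ => by simp only [funext_iff]

theorem sum_fiberCard_factorial {ι : Type*} [Fintype ι] [DecidableEq ι] {n : ℕ} (s : ι → ℕ)
    (hs : ∑ j, s j = n) :
    ∑ κ : Fin n → ι, (if ∀ j, fiberCard κ j = s j then ∏ j, ((fiberCard κ j).factorial : ℂ) else 0) =
      (n.factorial : ℂ) := by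
  rw [← Finset.sum_filter, Finset.sum_congr rfl fun κ hκ => by
    rw [Finset.prod_congr rfl fun j _ => by rw [(Finset.mem_filter.1 hκ).2 j]],
    Finset.sum_const, card_filter_fiberCard s hs, nsmul_eq_mul]
  have := Nat.multinomial_spec Finset.univ s
  rw [hs] at this
  rw [← this]
  push_cast
  ring

/-- The permutations supported in `S`. -/
def supportedPerms {N : ℕ} (S : Finset (Fin N)) : Finset (Equiv.Perm (Fin N)) :=
  Finset.univ.filter fun σ => ∀ i ∉ S, σ i = i

theorem sum_supportedPerms_fix {n : ℕ} (S : Finset (Fin (n + 1))) :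
    ∑ σ ∈ supportedPerms S, (if σ 0 = 0 then (1 : ℂ) else 0) = ((S.erase 0).card.factorial : ℂ) := by
  rw [← card_perm_supported, Finset.sum_boole, supportedPerms, Finset.filter_filter]
  congr 2
  ext σ
  simp only [Finset.mem_filter, Finset.mem_univ, true_and, Finset.mem_erase, not_and]
  constructor
  · rintro ⟨h1, h2⟩ i hi
    by_cases h : i = 0
    · rw [h, h2]
    · exact h1 i (hi h)
  · intro h
    exact ⟨fun i hi => h i fun _ => hi, h 0 fun h => absurd rfl h⟩

theorem sum_supportedPerms_not_fix {n : ℕ} (S : Finset (Fin (n + 1))) :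
    ∑ σ ∈ supportedPerms S, (if σ 0 = 0 then (0 : ℂ) else 1) =
      if 0 ∈ S then ((S.erase 0).card : ℂ) * ((S.erase 0).card.factorial : ℂ) else 0 := by
  have h : ∑ σ ∈ supportedPerms S, (if σ 0 = 0 then (0 : ℂ) else 1) =
      (S.card.factorial : ℂ) - ((S.erase 0).card.factorial : ℂ) := by
    rw [← sum_supportedPerms_fix, ← card_perm_supported, ← supportedPerms,
      Finset.cast_card, ← Finset.sum_sub_distrib]
    exact Finset.sum_congr rfl fun σ _ => by split_ifs <;> simp
  rw [h]
  split_ifs with h0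
  · rw [← Finset.card_erase_add_one h0, Nat.factorial_succ]
    push_cast; ring
  · rw [Finset.erase_eq_of_notMem h0, sub_self]

/-- The factorials count the families fixing `0`. Requiring one `σ l` to move `0` multiplies its
count by `|S l \ {0}|` when `0 ∈ S l`. -/
theorem sum_piFinset_supportedPerms {ι : Type*} [Fintype ι] [DecidableEq ι] {n a : ℕ}
    {S : ι → Finset (Fin (n + 1))} (hS : IsCovering S)
    (h0 : (Finset.univ.filter fun j => 0 ∈ S j).card = a + 1) {b : ℂ}
    (hb : ∀ τ : Equiv.Perm (Fin (n + 1)), τ 0 ≠ 0 → permPairing n a τ = b) :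
    ∑ σ ∈ Fintype.piFinset fun j => supportedPerms (S j),
      (∏ j, ((Equiv.Perm.sign (σ j) : ℤ) : ℂ)) *
        cornerPairing n a (fun U => partialPermMonomial S σ U.1) =
      (∏ j, (((S j).erase 0).card.factorial : ℂ)) * (permPairing n a 1 +
        b * ∑ l ∈ Finset.univ.filter (fun j => 0 ∈ S j), (((S l).erase 0).card : ℂ)) := by
  rw [Finset.sum_congr rfl fun σ hσ => prod_sign_mul_cornerPairing hS h0 (fun j => by
    have := Fintype.mem_piFinset.1 hσ j
    exact (Finset.mem_filter.1 this).2) hb]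
  rw [Finset.sum_add_distrib, ← Finset.mul_sum, ← Finset.mul_sum, Finset.sum_comm]
  simp only [← Finset.prod_univ_sum (fun j => supportedPerms (S j))
      (fun j σ => if σ 0 = 0 then (1 : ℂ) else 0), sum_supportedPerms_fix]
  have h1 : ∀ l, ∑ σ ∈ Fintype.piFinset fun j => supportedPerms (S j),
      ∏ j, (if j = l then (if σ j 0 = 0 then (0 : ℂ) else 1) else (if σ j 0 = 0 then 1 else 0)) =
      if 0 ∈ S l then (((S l).erase 0).card : ℂ) * ∏ j, (((S j).erase 0).card.factorial : ℂ)
        else 0 := by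
    intro l
    rw [← Finset.prod_univ_sum (fun j => supportedPerms (S j))
      (fun j σ => if j = l then (if σ 0 = 0 then (0 : ℂ) else 1) else (if σ 0 = 0 then 1 else 0)),
      ← Finset.mul_prod_erase _ _ (Finset.mem_univ l),
      ← Finset.mul_prod_erase _ (fun j => (((S j).erase 0).card.factorial : ℂ)) (Finset.mem_univ l)]
    simp only [if_true]
    rw [sum_supportedPerms_not_fix, Finset.prod_congr rfl fun j hj => by
      rw [Finset.sum_congr rfl fun σ _ => if_neg (Finset.ne_of_mem_erase hj),
        sum_supportedPerms_fix]]
    split_ifs <;> ring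
  simp only [h1]
  rw [← Finset.sum_filter, ← Finset.sum_mul]
  ring

/-- The family of subsets of `Fin (n+1)` determined by the indices of the sets containing `0` and
by the assignment `κ` of the nonzero elements. -/
def coveringOf {ι : Type*} [DecidableEq ι] {n : ℕ} (J : Finset ι) (κ : Fin n → ι) (j : ι) :
    Finset (Fin (n + 1)) :=
  (if j ∈ J then {0} else ∅) ∪ (Finset.univ.filter fun i => κ i = j).map (Fin.succEmb n)

theorem zero_mem_coveringOf {ι : Type*} [DecidableEq ι] {n : ℕ} {J : Finset ι} {κ : Fin n → ι}
    {j : ι} : 0 ∈ coveringOf J κ j ↔ j ∈ J := by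
  unfold coveringOf
  split_ifs with h <;> simp [h, Fin.succ_ne_zero]

theorem succ_mem_coveringOf {ι : Type*} [DecidableEq ι] {n : ℕ} {J : Finset ι} {κ : Fin n → ι}
    {j : ι} {i : Fin n} : i.succ ∈ coveringOf J κ j ↔ κ i = j := by
  unfold coveringOf
  split_ifs with h <;> simp [Fin.succ_ne_zero]

theorem card_erase_coveringOf {ι : Type*} [DecidableEq ι] {n : ℕ} (J : Finset ι) (κ : Fin n → ι)
    (j : ι) : ((coveringOf J κ j).erase 0).card = fiberCard κ j := by
  have h : (coveringOf J κ j).erase 0 =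
      (Finset.univ.filter fun i => κ i = j).map (Fin.succEmb n) := by
    ext i
    induction i using Fin.cases with
    | zero => simp [Fin.succ_ne_zero]
    | succ i => simp [Fin.succ_ne_zero, succ_mem_coveringOf]
  rw [h, Finset.card_map, fiberCard]

theorem card_coveringOf {ι : Type*} [DecidableEq ι] {n : ℕ} (J : Finset ι) (κ : Fin n → ι)
    (j : ι) : (coveringOf J κ j).card = fiberCard κ j + if j ∈ J then 1 else 0 := by
  rw [← card_erase_coveringOf J]
  split_ifs with h
  · rw [Finset.card_erase_add_one (zero_mem_coveringOf.2 h)]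
  · rw [Finset.erase_eq_of_notMem fun h' => h (zero_mem_coveringOf.1 h'), add_zero]

theorem isCovering_coveringOf {ι : Type*} [Fintype ι] [DecidableEq ι] {n : ℕ} (J : Finset ι)
    (κ : Fin n → ι) : IsCovering (coveringOf J κ) := by
  intro i hi
  obtain ⟨i, rfl⟩ := Fin.exists_succ_eq.2 hi
  rw [Finset.card_eq_one]
  refine ⟨κ i, ?_⟩
  ext j
  simp [succ_mem_coveringOf, eq_comm]

instance instDecidableIsCovering {ι : Type*} [Fintype ι] {n : ℕ} (S : ι → Finset (Fin (n + 1))) :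
    Decidable (IsCovering S) := by
  unfold IsCovering; infer_instance

theorem sum_card_filter_mem {ι : Type*} [Fintype ι] {N : ℕ} (S : ι → Finset (Fin N)) :
    ∑ i, (Finset.univ.filter fun j => i ∈ S j).card = ∑ j, (S j).card := by
  simp only [Finset.card_filter]
  rw [Finset.sum_comm]
  refine Finset.sum_congr rfl fun j _ => ?_
  rw [← Finset.card_filter]
  simp

theorem IsCovering.card_zero {ι : Type*} [Fintype ι] {n m : ℕ} {S : ι → Finset (Fin (n + 1))}
    (hS : IsCovering S) (h : ∑ j, (S j).card = n + m) :
    (Finset.univ.filter fun j => 0 ∈ S j).card = m := by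
  rw [← sum_card_filter_mem, Fin.sum_univ_succ,
    Finset.sum_congr rfl fun i _ => hS _ (Fin.succ_ne_zero i)] at h
  simp at h
  omega

/-- A covering amounts to the set `J` of indices whose set contains `0`, together with the owner `κ
i` of each nonzero element. The total size forces `|J| = m`. -/
theorem sum_covering_eq {ι : Type*} [Fintype ι] [DecidableEq ι] {n m : ℕ} (r : ι → ℕ)
    (hr : ∑ j, r j = n + m) (f : (ι → Finset (Fin (n + 1))) → ℂ) :
    ∑ S ∈ (Fintype.piFinset fun j => Finset.powersetCard (r j) Finset.univ).filter IsCovering, f S =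
      ∑ J ∈ Finset.powersetCard m Finset.univ, ∑ κ : Fin n → ι,
        if ∀ j, (fiberCard κ j + if j ∈ J then 1 else 0) = r j then f (coveringOf J κ) else 0 := by
  rw [← Finset.sum_product', ← Finset.sum_filter]
  symm
  refine Finset.sum_bij (fun x _ => coveringOf x.1 x.2) ?_ ?_ ?_ ?_
  · intro x hx
    simp only [Finset.mem_filter, Finset.mem_product] at hx
    simp only [Finset.mem_filter, Fintype.mem_piFinset, Finset.mem_powersetCard_univ]
    exact ⟨fun j => by rw [card_coveringOf, hx.2], isCovering_coveringOf _ _⟩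
  · intro x _ y _ hxy
    refine Prod.ext ?_ ?_
    · ext j
      rw [← zero_mem_coveringOf (κ := x.2), hxy, zero_mem_coveringOf]
    · funext i
      have h : i.succ ∈ coveringOf x.1 x.2 (x.2 i) := succ_mem_coveringOf.2 rfl
      rw [hxy, succ_mem_coveringOf] at h
      exact h.symm
  · intro S hS
    simp only [Finset.mem_filter, Fintype.mem_piFinset, Finset.mem_powersetCard_univ] at hS
    obtain ⟨hcard, hcov⟩ := hS
    have h1 : ∀ i : Fin n, ∃ j, i.succ ∈ S j := by
      intro i
      obtain ⟨j, hj⟩ := Finset.card_eq_one.1 (hcov _ (Fin.succ_ne_zero i))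
      refine ⟨j, ?_⟩
      have : j ∈ Finset.univ.filter fun j => i.succ ∈ S j := by rw [hj]; simp
      simpa using this
    choose κ hκ using h1
    have hS' : coveringOf (Finset.univ.filter fun j => 0 ∈ S j) κ = S := by
      funext j
      ext i
      induction i using Fin.cases with
      | zero => simp [zero_mem_coveringOf]
      | succ i =>
        rw [succ_mem_coveringOf]
        constructor
        · rintro rfl; exact hκ i
        · exact fun h => hcov.eq (Fin.succ_ne_zero i) (hκ i) h
    refine ⟨(Finset.univ.filter fun j => 0 ∈ S j, κ), ?_, hS'⟩
    simp only [Finset.mem_filter, Finset.mem_product, Finset.mem_powersetCard_univ,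
      Finset.mem_univ, and_true]
    refine ⟨hcov.card_zero (by rw [Finset.sum_congr rfl fun j _ => hcard j, hr]), fun j => ?_⟩
    have := card_coveringOf (Finset.univ.filter fun j => 0 ∈ S j) κ j
    rw [hS', hcard] at this
    simpa using this.symm
  · intro x _; rfl

theorem minorSum_eq_sum {N : ℕ} (r : ℕ) (M : Matrix (Fin N) (Fin N) ℂ) :
    minorSum r M = ∑ S ∈ Finset.powersetCard r Finset.univ, ∑ σ ∈ supportedPerms S,
      ((Equiv.Perm.sign σ : ℤ) : ℂ) * ∏ i ∈ S, M i (σ i) := by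
  rw [minorSum, Finset.sum_sigma']
  refine Finset.sum_bij' (fun p _ => ⟨p.1, p.2⟩) (fun p _ => (p.1, p.2)) ?_ ?_ ?_ ?_ ?_
  · intro p hp
    simpa [minorIndex, supportedPerms] using hp
  · intro p hp
    simpa [minorIndex, supportedPerms] using hp
  · intro p _; rfl
  · intro p _; rfl
  · intro p _; rfl

theorem prod_minorSum_eq_sum {ι : Type*} [Fintype ι] [DecidableEq ι] {N : ℕ} (r : ι → ℕ)
    (M : Matrix (Fin N) (Fin N) ℂ) :
    ∏ j, minorSum (r j) M = ∑ S ∈ Fintype.piFinset fun j => Finset.powersetCard (r j) Finset.univ,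
      ∑ σ ∈ Fintype.piFinset fun j => supportedPerms (S j),
        (∏ j, ((Equiv.Perm.sign (σ j) : ℤ) : ℂ)) * partialPermMonomial S σ M := by
  simp only [minorSum_eq_sum]
  rw [Finset.prod_univ_sum]
  refine Finset.sum_congr rfl fun S _ => ?_
  rw [Finset.prod_univ_sum]
  refine Finset.sum_congr rfl fun σ _ => ?_
  rw [Finset.prod_mul_distrib, partialPermMonomial]

/-- Each `l ∈ K` lies in `C(|K| - 1, a)` of the subsets of size `a + 1`. -/
theorem sum_powersetCard_sum {ι : Type*} [DecidableEq ι] (K : Finset ι) (a : ℕ) (f : ι → ℂ) :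
    ∑ J ∈ Finset.powersetCard (a + 1) K, ∑ l ∈ J, f l =
      ((K.card - 1).choose a : ℂ) * ∑ l ∈ K, f l := by
  rw [Finset.sum_comm' (s' := fun l => (Finset.powersetCard (a + 1) K).filter (l ∈ ·)) (t' := K),
    Finset.mul_sum]
  · refine Finset.sum_congr rfl fun l hl => ?_
    rw [Finset.sum_const, nsmul_eq_mul]
    congr 2
    rw [← Finset.card_erase_of_mem hl, ← Finset.card_powersetCard]
    refine Finset.card_bij' (fun J _ => J.erase l) (fun J _ => insert l J) ?_ ?_ ?_ ?_
    · intro J hJ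
      simp only [Finset.mem_filter, Finset.mem_powersetCard] at hJ ⊢
      exact ⟨Finset.erase_subset_erase _ hJ.1.1, by rw [Finset.card_erase_of_mem hJ.2, hJ.1.2]; rfl⟩
    · intro J hJ
      simp only [Finset.mem_filter, Finset.mem_powersetCard] at hJ ⊢
      have h1 : l ∉ J := fun h => Finset.notMem_erase l K (hJ.1 h)
      refine ⟨⟨?_, by rw [Finset.card_insert_of_notMem h1, hJ.2]⟩, Finset.mem_insert_self _ _⟩
      exact Finset.insert_subset hl (hJ.1.trans (Finset.erase_subset _ _))
    · intro J hJ
      exact Finset.insert_erase (Finset.mem_filter.1 hJ).2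
    · intro J hJ
      exact Finset.erase_insert fun h => Finset.notMem_erase l K ((Finset.mem_powersetCard.1 hJ).1 h)
  · intro J l
    simp only [Finset.mem_filter, Finset.mem_powersetCard]
    constructor
    · rintro ⟨⟨h1, h2⟩, h3⟩; exact ⟨⟨⟨h1, h2⟩, h3⟩, h1 h3⟩
    · rintro ⟨⟨⟨h1, h2⟩, h3⟩, _⟩; exact ⟨⟨h1, h2⟩, h3⟩

/-- The pairing of a product of sums of principal minors with `U₀₀ ^ a * det U`. -/
theorem cornerPairing_prod_minorSum {ι : Type*} [Fintype ι] [DecidableEq ι] {n : ℕ} (hn : 1 ≤ n)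
    (a : ℕ) (r : ι → ℕ) (hr : ∑ j, r j = n + (a + 1)) :
    cornerPairing n a (fun U => ∏ j, minorSum (r j) U.1) =
      entryMoment n a * (((Finset.univ.filter fun j => 1 ≤ r j).card - 1).choose a : ℂ) := by
  set K := Finset.univ.filter fun j => 1 ≤ r j with hK
  set b : ℂ := entryMoment n (a + 1) / (n.factorial * (a + 1)) with hb
  have ha0 : (a : ℂ) + 1 ≠ 0 := by exact_mod_cast Nat.succ_ne_zero a
  have hn0 : (n.factorial : ℂ) ≠ 0 := by exact_mod_cast n.factorial_ne_zero
  have hb' : ∀ τ : Equiv.Perm (Fin (n + 1)), τ 0 ≠ 0 → permPairing n a τ = b := by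
    intro τ hτ
    rw [hb, eq_div_iff (mul_ne_zero hn0 ha0), ← factorial_mul_permPairing hn a hτ]
    ring
  have h1 : cornerPairing n a (fun U => ∏ j, minorSum (r j) U.1) =
      ∑ S ∈ Fintype.piFinset fun j => Finset.powersetCard (r j) Finset.univ,
      ∑ σ ∈ Fintype.piFinset fun j => supportedPerms (S j),
        (∏ j, ((Equiv.Perm.sign (σ j) : ℤ) : ℂ)) *
          cornerPairing n a (fun U => partialPermMonomial S σ U.1) := by
    simp only [prod_minorSum_eq_sum]
    have h2 := cornerPairing_sum (n := n) a
      (Fintype.piFinset fun j => Finset.powersetCard (r j) Finset.univ) (fun _ => 1)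
      (fun S U => ∑ σ ∈ Fintype.piFinset fun j => supportedPerms (S j),
        (∏ j, ((Equiv.Perm.sign (σ j) : ℤ) : ℂ)) * partialPermMonomial S σ U.1)
      (fun S _ => continuous_finsetSum _ fun σ _ => continuous_const.mul
        (continuous_partialPermMonomial S σ))
    simp only [one_mul] at h2
    rw [h2]
    exact Finset.sum_congr rfl fun S _ => cornerPairing_sum _ _ _ _ fun σ _ =>
      continuous_partialPermMonomial S σ
  rw [h1, ← Finset.sum_filter_add_sum_filter_not _ IsCovering]
  rw [Finset.sum_eq_zero (s := Finset.filter (fun S => ¬ IsCovering S) _) fun S hS =>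
    Finset.sum_eq_zero fun σ _ => by
      rw [cornerPairing_partialPermMonomial_eq_zero σ (Finset.mem_filter.1 hS).2, mul_zero], add_zero]
  rw [Finset.sum_congr rfl fun S hS => sum_piFinset_supportedPerms (Finset.mem_filter.1 hS).2
    ((Finset.mem_filter.1 hS).2.card_zero (by
      rw [← hr]
      exact Finset.sum_congr rfl fun j _ => Finset.mem_powersetCard_univ.1
        (Fintype.mem_piFinset.1 (Finset.mem_filter.1 hS).1 j))) hb']
  rw [sum_covering_eq r hr]
  simp only [card_erase_coveringOf, zero_mem_coveringOf, Finset.filter_mem_eq_inter,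
    Finset.univ_inter]
  -- For `j ∈ J` one unit of `r j` is spent on the element `0`, which requires `r j ≥ 1`, that is `J
  -- ⊆ K`. The multinomial count cancels the factorials, and the two basic values combine into a
  -- multiple of `Σ_{l ∈ J} r l`.
  have h3 : ∀ J ∈ Finset.powersetCard (a + 1) (Finset.univ : Finset ι), (∑ κ : Fin n → ι,
      if ∀ j, (fiberCard κ j + if j ∈ J then 1 else 0) = r j then
        (∏ j, ((fiberCard κ j).factorial : ℂ)) * (permPairing n a 1 +
          b * ∑ l ∈ J, (fiberCard κ l : ℂ)) else 0) =
      if J ⊆ K then entryMoment n (a + 1) / (a + 1) * ∑ l ∈ J, (r l : ℂ) else 0 := by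
    intro J hJ
    have hJc := Finset.mem_powersetCard_univ.1 hJ
    split_ifs with hJK
    · have hs : ∀ j, (r j - if j ∈ J then 1 else 0) + (if j ∈ J then 1 else 0) = r j := by
        intro j
        split_ifs with h
        · have := (Finset.mem_filter.1 (hJK h)).2; omega
        · omega
      have hsum : ∑ j, (r j - if j ∈ J then 1 else 0) = n := by
        have h4 := hr
        rw [← Finset.sum_congr rfl fun j _ => hs j, Finset.sum_add_distrib, Finset.sum_boole] at h4
        simp [hJc] at h4
        omega
      have h5 := sum_fiberCard_factorial _ hsum
      have h6 : ∑ l ∈ J, ((r l : ℂ) - 1) = (∑ l ∈ J, (r l : ℂ)) - (a + 1) := by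
        rw [Finset.sum_sub_distrib, Finset.sum_const, hJc]; simp
      have h7 : entryMoment n (a + 1) / (a + 1) * ∑ l ∈ J, (r l : ℂ) =
          n.factorial * (permPairing n a 1 + b * ∑ l ∈ J, ((r l : ℂ) - 1)) := by
        rw [h6, hb, mul_add, factorial_mul_permPairing_one]
        field_simp
        ring
      rw [h7, ← h5, Finset.sum_mul]
      refine Finset.sum_congr rfl fun κ _ => ?_
      have hiff : (∀ j, (fiberCard κ j + if j ∈ J then 1 else 0) = r j) ↔
          ∀ j, fiberCard κ j = r j - if j ∈ J then 1 else 0 :=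
        forall_congr' fun j => by have := hs j; omega
      simp only [hiff]
      split_ifs with h8
      · congr 3
        refine Finset.sum_congr rfl fun l hl => ?_
        have := hs l
        rw [h8 l]
        rw [if_pos hl] at this ⊢
        rw [← this]; push_cast; simp
      · rw [zero_mul]
    · obtain ⟨j, hj, hjK⟩ := Finset.not_subset.1 hJK
      refine Finset.sum_eq_zero fun κ _ => if_neg fun h => hjK ?_
      have := h j
      rw [if_pos hj] at this
      exact Finset.mem_filter.2 ⟨Finset.mem_univ j, by omega⟩
  rw [Finset.sum_congr rfl h3, ← Finset.sum_filter]
  have h9 : (Finset.powersetCard (a + 1) (Finset.univ : Finset ι)).filter (· ⊆ K) =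
      Finset.powersetCard (a + 1) K := by
    ext J
    simp [Finset.mem_powersetCard, and_comm]
  rw [h9, ← Finset.mul_sum, sum_powersetCard_sum]
  have h10 : ∑ l ∈ K, (r l : ℂ) = n + (a + 1) := by
    have : ∑ l ∈ K, r l = n + (a + 1) := by
      rw [← hr, hK, Finset.sum_filter]
      exact Finset.sum_congr rfl fun j _ => by split_ifs <;> omega
    exact_mod_cast this
  rw [h10]
  have h11 := entryMoment_succ n a
  have h12 : entryMoment n (a + 1) / (a + 1) * ((n : ℂ) + (a + 1)) = entryMoment n a := by
    rw [div_mul_eq_mul_div, div_eq_iff ha0, ← h11]; ring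
  rw [← h12]; ring

/-! ### The expectation as a finite sum. -/

theorem Z_eq_sum_minorSum {N : ℕ} (U : Matrix.unitaryGroup (Fin N) ℂ) (θ : ℝ) :
    Z U θ = ∑ r ∈ Finset.range (N + 1), (-1) ^ r * minorSum r U.1 *
      Complex.exp (-(Complex.I * r) * θ) := by
  have h := det_one_add_smul_eq_sum_minorSum U.1 (-Complex.exp (-(Complex.I * θ)))
  rw [neg_smul, ← sub_eq_add_neg] at h
  rw [Z, h]
  refine Finset.sum_congr rfl fun r _ => ?_
  rw [neg_pow, ← Complex.exp_nat_mul]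
  rw [show (r : ℂ) * -(Complex.I * θ) = -(Complex.I * r) * θ by ring]
  ring

theorem iteratedDeriv_Z {N : ℕ} (U : Matrix.unitaryGroup (Fin N) ℂ) (m : ℕ) :
    iteratedDeriv m (Z U) = fun θ : ℝ => ∑ r ∈ Finset.range (N + 1), (-1) ^ r * minorSum r U.1 *
      (-(Complex.I * r)) ^ m * Complex.exp (-(Complex.I * r) * θ) := by
  induction m with
  | zero =>
    funext θ
    simp [Z_eq_sum_minorSum]
  | succ m ih =>
    rw [iteratedDeriv_succ, ih]
    funext θ
    refine HasDerivAt.deriv ?_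
    refine HasDerivAt.fun_sum fun r _ => ?_
    have h1 : HasDerivAt (fun θ : ℝ => -(Complex.I * r) * (θ : ℂ)) (-(Complex.I * r)) θ := by
      simpa using (Complex.ofRealCLM.hasDerivAt (x := θ)).const_mul (-(Complex.I * r))
    refine (h1.cexp.const_mul ((-1) ^ r * minorSum r U.1 * (-(Complex.I * r)) ^ m)).congr_deriv ?_
    ring

theorem exp_neg_I_mul_arg {z : ℂ} (hz : ‖z‖ = 1) (r : ℕ) :
    Complex.exp (-(Complex.I * r) * z.arg) = starRingEnd ℂ z ^ r := by
  have h := Complex.norm_mul_exp_arg_mul_I z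
  rw [hz, Complex.ofReal_one, one_mul] at h
  conv_rhs => rw [← h]
  rw [← Complex.exp_conj, ← Complex.exp_nat_mul]
  congr 1
  simp
  ring

/-- At the eigenvalue `u_i` the exponentials multiply to `conj u_i ^ Σ r_j`; summing over `i`
produces the conjugate power sum. -/
theorem mixedDerivAverage_eq {k : ℕ} (m : Fin k → ℕ) {N : ℕ} (U : Matrix.unitaryGroup (Fin N) ℂ) :
    mixedDerivAverage m U = (1 / (N : ℂ)) *
      ∑ r ∈ Fintype.piFinset fun _ : Fin k => Finset.range (N + 1),
        (∏ j, (-1) ^ r j * (-(Complex.I * r j)) ^ m j) *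
          (starRingEnd ℂ (eigenPowerSum (∑ j, r j) U.1) * ∏ j, minorSum (r j) U.1) := by
  obtain ⟨W, u, h⟩ := exists_unitary_diagonal U
  have hroots : U.1.charpoly.roots = Finset.univ.val.map u := by
    conv_lhs => rw [h]
    exact roots_charpoly_unitary_diagonal W u
  have hp : ∀ R, eigenPowerSum R U.1 = ∑ i, u i ^ R := by
    intro R
    rw [eigenPowerSum, hroots, Multiset.map_map]
    rfl
  rw [mixedDerivAverage, eigenangles, hroots, Multiset.map_map, Multiset.map_map]
  congr 1
  change ∑ i, ∏ j, iteratedDeriv (m j) (Z U) (u i).arg = _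
  simp only [iteratedDeriv_Z, exp_neg_I_mul_arg (norm_eq_one_of_unitary_diagonal h _), hp]
  simp only [Finset.prod_univ_sum]
  rw [Finset.sum_comm]
  refine Finset.sum_congr rfl fun r _ => ?_
  rw [map_sum, Finset.sum_mul, Finset.mul_sum]
  refine Finset.sum_congr rfl fun i _ => ?_
  simp only [Finset.prod_mul_distrib, Finset.prod_pow_eq_pow_sum, map_pow]
  ring

theorem continuous_prod_minorSum {N k : ℕ} (r : Fin k → ℕ) :
    Continuous fun U : Matrix.unitaryGroup (Fin N) ℂ => ∏ j, minorSum (r j) U.1 :=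
  continuous_finsetProd _ fun _ _ => continuous_minorSum _

theorem continuous_eigenPowerSum {n R : ℕ} (hR : 1 ≤ R) :
    Continuous fun U : Matrix.unitaryGroup (Fin (n + 1)) ℂ => eigenPowerSum R U.1 := by
  simp only [eigenPowerSum_eq hR]
  exact continuous_finsetSum _ fun c _ => (continuous_const.mul (continuous_minorSum c)).mul
    (continuous_const.mul (continuous_conjAverage n (R - c)))

/-- The mixed moment of a power sum and elementary symmetric functions of the eigenvalues. -/
theorem integral_conj_eigenPowerSum_mul_prod_minorSum {n k : ℕ} (hn : 1 ≤ n) (hk : 1 ≤ k)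
    {r : Fin k → ℕ} (hr : ∀ j, 1 ≤ r j) :
    ∫ U : Matrix.unitaryGroup (Fin (n + 1)) ℂ,
      starRingEnd ℂ (eigenPowerSum (∑ j, r j) U.1) * ∏ j, minorSum (r j) U.1 ∂(haar (n + 1)) =
      ∑ c ∈ (Finset.range (n + 2)).filter (· ≤ ∑ j, r j), (-1) ^ (c + 1) * (c : ℂ) *
        ((k - if c = n + 1 then 1 else 0).choose (∑ j, r j - c) : ℂ) := by
  have hR : 1 ≤ ∑ j, r j :=
    (hr ⟨0, by omega⟩).trans (Finset.single_le_sum (fun _ _ => Nat.zero_le _) (Finset.mem_univ _))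
  rw [integral_conj_eigenPowerSum_mul hR (continuous_prod_minorSum r) fun U V => by
    simp only [Submonoid.coe_mul, Unitary.coe_star, minorSum_unitary_conj]]
  have hset : (Finset.range (∑ j, r j + 1)).filter (· ≤ n + 1) =
      (Finset.range (n + 2)).filter (· ≤ ∑ j, r j) := by
    ext c; simp only [Finset.mem_filter, Finset.mem_range]; omega
  rw [hset]
  refine Finset.sum_congr rfl fun c hc => ?_
  simp only [Finset.mem_filter, Finset.mem_range] at hc
  congr 1
  set R := ∑ j, r j with hRdef
  have h := cornerPairing_prod_minorSum hn (R - c)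
    (fun o : Option (Fin k) => o.elim (n + 1 - c) r) (by
      rw [Fintype.sum_option]
      simp only [Option.elim_none, Option.elim_some, ← hRdef]
      omega)
  simp only [Fintype.prod_option, Option.elim_none, Option.elim_some] at h
  rw [cornerPairing] at h
  -- The extra index `none` carries `e_{n+1-c}`. It has positive degree, and so is counted, except
  -- when `c = n + 1`.
  have hcard : (Finset.univ.filter fun o : Option (Fin k) => 1 ≤ o.elim (n + 1 - c) r).card - 1 =
      k - if c = n + 1 then 1 else 0 := by
    have h1 : ∀ j : Fin k, 1 ≤ (some j).elim (n + 1 - c) r := fun j => hr j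
    have h2 : 1 ≤ (none : Option (Fin k)).elim (n + 1 - c) r ↔ c ≠ n + 1 := by
      rw [Option.elim_none]; omega
    rw [Finset.card_filter, Fintype.sum_option, Finset.sum_congr rfl fun j _ => if_pos (h1 j)]
    simp only [h2, Finset.sum_const, Finset.card_univ, Fintype.card_fin, smul_eq_mul, mul_one]
    by_cases h' : c = n + 1
    · rw [if_pos h', if_neg (not_not.2 h')]; omega
    · rw [if_neg h', if_pos h']; omega
  rw [hcard] at h
  rw [h, ← mul_assoc, mul_comm (((n + (R - c)).choose (R - c) : ℕ) : ℂ),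
    entryMoment_mul_choose, one_mul]

theorem expectation_mixedDerivAverage_eq {n k : ℕ} (hn : 1 ≤ n) (hk : 1 ≤ k) {m : Fin k → ℕ}
    (hm : ∀ j, 1 ≤ m j) :
    expectation (n + 1) (fun U => mixedDerivAverage m U) = (1 / ((n + 1 : ℕ) : ℂ)) *
      ∑ r ∈ Fintype.piFinset fun _ : Fin k => Finset.Icc 1 (n + 1),
        (∏ j, (-1) ^ r j * (-(Complex.I * r j)) ^ m j) *
          ∑ c ∈ (Finset.range (n + 2)).filter (· ≤ ∑ j, r j), (-1) ^ (c + 1) * (c : ℂ) *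
            ((k - if c = n + 1 then 1 else 0).choose (∑ j, r j - c) : ℂ) := by
  have h1 : ∀ U : Matrix.unitaryGroup (Fin (n + 1)) ℂ, mixedDerivAverage m U =
      (1 / ((n + 1 : ℕ) : ℂ)) * ∑ r ∈ Fintype.piFinset fun _ : Fin k => Finset.Icc 1 (n + 1),
        (∏ j, (-1) ^ r j * (-(Complex.I * r j)) ^ m j) *
          (starRingEnd ℂ (eigenPowerSum (∑ j, r j) U.1) * ∏ j, minorSum (r j) U.1) := by
    intro U
    rw [mixedDerivAverage_eq]
    congr 1
    symm
    -- Terms with some `r j = 0` vanish, since each factor is differentiated at least once.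
    refine Finset.sum_subset ?_ ?_
    · exact Fintype.piFinset_subset _ _ fun j x hx => by
        simp only [Finset.mem_Icc, Finset.mem_range] at hx ⊢; omega
    · intro r hr hr'
      simp only [Fintype.mem_piFinset, Finset.mem_range, Finset.mem_Icc] at hr hr'
      push Not at hr'
      obtain ⟨j, hj⟩ := hr'
      have hj0 : r j = 0 := by
        by_contra h
        have h2 := hj (by omega)
        have h3 := hr j
        omega
      have hmj : m j ≠ 0 := by have := hm j; omega
      rw [Finset.prod_eq_zero (Finset.mem_univ j), zero_mul]
      simp [hj0, hmj]
  have hmem : ∀ r ∈ Fintype.piFinset fun _ : Fin k => Finset.Icc 1 (n + 1), ∀ j, 1 ≤ r j := by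
    intro r hr j
    exact (Finset.mem_Icc.1 (Fintype.mem_piFinset.1 hr j)).1
  rw [expectation]
  simp only [h1]
  rw [integral_const_mul]
  congr 1
  rw [integral_finsetSum]
  · refine Finset.sum_congr rfl fun r hr => ?_
    rw [integral_const_mul, integral_conj_eigenPowerSum_mul_prod_minorSum hn hk (hmem r hr)]
  · intro r hr
    have hR : 1 ≤ ∑ j, r j := (hmem r hr ⟨0, by omega⟩).trans
      (Finset.single_le_sum (fun _ _ => Nat.zero_le _) (Finset.mem_univ _))
    exact (integrable_haar ((Complex.continuous_conj.comp (continuous_eigenPowerSum hR)).mul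
      (continuous_prod_minorSum r))).const_mul _

/-! ### Binomial convolutions, finite differences and Abel summation. -/

theorem coeff_prod_eq_sum_piAntidiag {k : ℕ} (f : Fin k → PowerSeries ℂ) (M : ℕ) :
    PowerSeries.coeff M (∏ j, f j) =
      ∑ r ∈ Finset.piAntidiag Finset.univ M, ∏ j, PowerSeries.coeff (r j) (f j) := by
  rw [PowerSeries.coeff_prod]
  refine Finset.sum_bij' (fun α _ => ⇑α) (fun α _ => Finsupp.equivFunOnFinite.symm α) ?_ ?_ ?_ ?_ ?_
  · intro α hα; simpa using hα
  · intro α hα; simpa using hα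
  · intro α _; ext; simp
  · intro α _; rfl
  · intro α _; simp

theorem chooseSeries_mul (p : ℕ) :
    (PowerSeries.mk fun m => (m.choose p : ℂ)) * (1 - PowerSeries.X) ^ (p + 1) =
      PowerSeries.X ^ p := by
  induction p with
  | zero =>
    have h := geometric_mul_one_sub 1
    simpa using h
  | succ p ih =>
    have h : (PowerSeries.mk fun m => (m.choose (p + 1) : ℂ)) * (1 - PowerSeries.X) =
        PowerSeries.X * PowerSeries.mk fun m => (m.choose p : ℂ) := by
      ext m
      rw [mul_sub, map_sub, mul_one]
      cases m with
      | zero => simp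
      | succ m =>
        rw [PowerSeries.coeff_succ_mul_X, PowerSeries.coeff_succ_X_mul]
        simp only [PowerSeries.coeff_mk, Nat.choose_succ_succ' m p]
        push_cast; ring
    rw [pow_succ' _ (p + 1), ← mul_assoc, h, mul_assoc, ih, pow_succ']

/-- The convolution of binomial coefficients. -/
theorem sum_piAntidiag_prod_choose {k : ℕ} (p : Fin (k + 1) → ℕ) (M : ℕ) :
    ∑ r ∈ Finset.piAntidiag Finset.univ M, ∏ j, ((r j).choose (p j) : ℂ) =
      ((M + k).choose (∑ j, p j + k) : ℂ) := by
  set q := ∑ j, p j with hq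
  have h1 : (∏ j, PowerSeries.mk fun m => (m.choose (p j) : ℂ)) * (1 - PowerSeries.X) ^ (q + k + 1) =
      PowerSeries.X ^ q := by
    have : q + k + 1 = ∑ j, (p j + 1) := by
      rw [Finset.sum_add_distrib, ← hq]; simp [add_assoc]
    rw [this, ← Finset.prod_pow_eq_pow_sum, ← Finset.prod_mul_distrib,
      Finset.prod_congr rfl fun j _ => chooseSeries_mul (p j), Finset.prod_pow_eq_pow_sum]
  have hne : (1 - PowerSeries.X : PowerSeries ℂ) ^ (q + k + 1) ≠ 0 := by
    refine pow_ne_zero _ fun h => ?_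
    have := congrArg (PowerSeries.coeff 0) h
    simp at this
  -- The product series is `X^q / (1 - X)^(q+k+1)`; the factor `X^k` turns it into the series of
  -- `C(m, q + k)`, whence the shift to `M + k`.
  have h2 : (∏ j, PowerSeries.mk fun m => (m.choose (p j) : ℂ)) * PowerSeries.X ^ k =
      PowerSeries.mk fun m => (m.choose (q + k) : ℂ) := by
    apply mul_right_cancel₀ hne
    rw [chooseSeries_mul, mul_right_comm, h1, pow_add]
  have h3 := congrArg (PowerSeries.coeff (M + k)) h2
  rw [PowerSeries.coeff_mul_X_pow, coeff_prod_eq_sum_piAntidiag] at h3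
  simpa using h3

/-- Powers are integral combinations of binomial coefficients. -/
theorem exists_pow_eq_sum_choose (n : ℕ) : ∃ β : ℕ → ℂ, β n = n.factorial ∧
    ∀ m : ℕ, (m : ℂ) ^ n = ∑ p ∈ Finset.range (n + 1), β p * (m.choose p : ℂ) := by
  induction n with
  | zero => exact ⟨fun _ => 1, by simp, by simp⟩
  | succ n ih =>
    obtain ⟨β, hβ, h⟩ := ih
    refine ⟨fun p => (if p = 0 then 0 else p * β (p - 1)) + if p ≤ n then p * β p else 0, ?_, ?_⟩
    · simp [hβ, Nat.factorial_succ]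
    · intro m
      have h1 : ∀ p, (m : ℂ) * (m.choose p : ℂ) =
          (p + 1) * (m.choose (p + 1) : ℂ) + p * (m.choose p : ℂ) := by
        intro p
        have h2 : ((m + 1).choose (p + 1) : ℂ) * (p + 1) = (m + 1) * m.choose p := by
          exact_mod_cast (Nat.add_one_mul_choose_eq m p).symm
        rw [Nat.choose_succ_succ'] at h2
        push_cast at h2
        linear_combination -h2
      rw [pow_succ', h m, Finset.mul_sum]
      simp only [add_mul, Finset.sum_add_distrib]
      rw [Finset.sum_range_succ' _ (n + 1)]
      rw [Finset.sum_range_succ (fun p => (if p ≤ n then (p : ℂ) * β p else 0) * (m.choose p : ℂ))]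
      simp only [if_true, zero_mul, add_zero, Nat.add_one_ne_zero, if_false, Nat.add_sub_cancel,
        show ¬ (n + 1 ≤ n) by omega]
      rw [← Finset.sum_add_distrib]
      refine Finset.sum_congr rfl fun p hp => ?_
      rw [if_pos (by have := Finset.mem_range.1 hp; omega)]
      push_cast
      linear_combination β p * h1 p

/-- Alternating binomial sums, i.e. iterated differences up to sign. -/
noncomputable def altSum (k : ℕ) (f : ℕ → ℂ) (y : ℕ) : ℂ :=
  ∑ a ∈ Finset.range (k + 1), (-1) ^ a * (k.choose a : ℂ) * f (y + a)

theorem altSum_succ (k : ℕ) (f : ℕ → ℂ) (y : ℕ) :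
    altSum (k + 1) f y = altSum k f y - altSum k f (y + 1) := by
  have h1 : altSum k f y = ∑ a ∈ Finset.range (k + 2), (-1) ^ a * (k.choose a : ℂ) * f (y + a) := by
    rw [Finset.sum_range_succ]; simp [altSum]
  rw [h1, altSum, Finset.sum_range_succ', Finset.sum_range_succ' _ (k + 1), altSum]
  rw [add_sub_right_comm, ← Finset.sum_sub_distrib]
  congr 1
  · refine Finset.sum_congr rfl fun a _ => ?_
    rw [Nat.choose_succ_succ' k a, show y + 1 + a = y + (a + 1) by ring]
    push_cast; ring
  · simp

/-- `altSum k` is `(-Δ)^k`, and by Pascal's rule each difference lowers the lower index by one. -/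
theorem altSum_choose (k q y : ℕ) :
    altSum k (fun x => (x.choose (q + k) : ℂ)) y = (-1) ^ k * (y.choose q : ℂ) := by
  induction k generalizing q y with
  | zero => simp [altSum]
  | succ k ih =>
    rw [altSum_succ]
    have h : (fun x : ℕ => (x.choose (q + (k + 1)) : ℂ)) = fun x : ℕ => (x.choose (q + 1 + k) : ℂ) := by
      funext x; rw [add_right_comm, add_assoc]
    rw [h, ih, ih, Nat.choose_succ_succ' y q]
    push_cast; ring

theorem altSum_sum {κ : Type*} (s : Finset κ) (c : κ → ℂ) (f : κ → ℕ → ℂ) (k y : ℕ) :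
    altSum k (fun x => ∑ i ∈ s, c i * f i x) y = ∑ i ∈ s, c i * altSum k (f i) y := by
  simp only [altSum, Finset.mul_sum]
  rw [Finset.sum_comm]
  exact Finset.sum_congr rfl fun i _ => Finset.sum_congr rfl fun a _ => by ring

/-- The sum of `∏ r_j ^ m_j` over all `r` of total `M`. -/
noncomputable def powerConvolution {k : ℕ} (m : Fin k → ℕ) (M : ℕ) : ℂ :=
  ∑ r ∈ Finset.piAntidiag Finset.univ M, ∏ j, (r j : ℂ) ^ m j

/-- The upper bound of the box is automatic: the binomial forces `Σ r_j ≤ c + w ≤ n + 1 + k`, and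
the other `k` coordinates are at least `1`. The lower bound is free too, since `r_j = 0` contributes
nothing. -/
theorem sum_box_eq {k n c w : ℕ} {m : Fin (k + 1) → ℕ} (hm : ∀ j, 1 ≤ m j)
    (hw : c + w ≤ n + 1 + k) (hwk : w ≤ k + 1) :
    ∑ r ∈ (Fintype.piFinset fun _ : Fin (k + 1) => Finset.Icc 1 (n + 1)).filter (fun r => c ≤ ∑ j, r j),
        (-1) ^ (∑ j, r j) * (∏ j, (r j : ℂ) ^ m j) * (w.choose (∑ j, r j - c) : ℂ) =
      ∑ a ∈ Finset.range (k + 2), (-1) ^ (c + a) * (w.choose a : ℂ) * powerConvolution m (c + a) := by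
  simp only [powerConvolution, Finset.mul_sum]
  rw [Finset.sum_sigma']
  refine Finset.sum_bij_ne_zero (fun r _ _ => ⟨∑ j, r j - c, r⟩) ?_ ?_ ?_ ?_
  · intro r hr h0
    simp only [Finset.mem_filter] at hr
    have h1 : (w.choose (∑ j, r j - c) : ℂ) ≠ 0 := right_ne_zero_of_mul h0
    have h2 : ∑ j, r j - c ≤ w := by
      by_contra h
      exact h1 (by rw [Nat.choose_eq_zero_of_lt (by omega), Nat.cast_zero])
    simp only [Finset.mem_sigma, Finset.mem_range, Finset.mem_piAntidiag, Finset.mem_univ,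
      implies_true, and_true]
    exact ⟨by omega, (Nat.add_sub_cancel' hr.2).symm⟩
  · intro r _ _ r' _ _ h
    simp only [Sigma.mk.injEq] at h
    exact eq_of_heq h.2
  · rintro ⟨a, r⟩ har h0
    simp only [Finset.mem_sigma, Finset.mem_range, Finset.mem_piAntidiag, Finset.mem_univ,
      implies_true, and_true] at har
    have htot : ∑ j, r j = c + a := har.2
    have h1 : (w.choose a : ℂ) ≠ 0 := right_ne_zero_of_mul (left_ne_zero_of_mul h0)
    have h2 : a ≤ w := by
      by_contra h
      exact h1 (by rw [Nat.choose_eq_zero_of_lt (by omega), Nat.cast_zero])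
    have h3 : ∀ j, 1 ≤ r j := by
      intro j
      by_contra h
      have hj : r j = 0 := by omega
      have hmj : m j ≠ 0 := by have := hm j; omega
      apply right_ne_zero_of_mul h0
      exact Finset.prod_eq_zero (Finset.mem_univ j) (by simp [hj, hmj])
    have h4 : ∀ j, r j ≤ n + 1 := by
      intro j
      have h5 := Finset.add_sum_erase Finset.univ r (Finset.mem_univ j)
      have h6 : ∑ l ∈ Finset.univ.erase j, 1 ≤ ∑ l ∈ Finset.univ.erase j, r l :=
        Finset.sum_le_sum fun l _ => h3 l
      rw [Finset.sum_const, Finset.card_erase_of_mem (Finset.mem_univ j), Finset.card_univ,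
        Fintype.card_fin, smul_eq_mul, mul_one, Nat.add_sub_cancel] at h6
      omega
    have hsub : ∑ j, r j - c = a := by rw [har.2]; omega
    refine ⟨r, ?_, ?_, ?_⟩
    · simp only [Finset.mem_filter, Fintype.mem_piFinset, Finset.mem_Icc]
      exact ⟨fun j => ⟨h3 j, h4 j⟩, by omega⟩
    · rw [hsub, har.2]
      intro h; apply h0
      linear_combination h
    · rw [hsub]
  · intro r hr _
    simp only [Finset.mem_filter] at hr
    simp only []
    rw [Nat.add_sub_cancel' hr.2]
    ring

theorem sum_range_mul_sub (T : ℕ → ℂ) (N : ℕ) :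
    (∑ c ∈ Finset.range (N + 1), (c : ℂ) * (T c - T (c + 1))) + (N + 1 : ℂ) * T (N + 1) =
      ∑ c ∈ Finset.range (N + 1), T (c + 1) := by
  induction N with
  | zero => simp
  | succ N ih =>
    rw [Finset.sum_range_succ, Finset.sum_range_succ _ (N + 1), ← ih]
    push_cast; ring

/-- With `T = altSum k (powerConvolution m)`, each `c ≤ n` has weights `C(k+1, ·)` and gives `c (T c
- T (c+1))`. At `c = n + 1` the weights are `C(k, ·)` and give `T` itself, exactly the boundary term
that Abel summation needs. -/
theorem sum_expectation_eq {k n : ℕ} {m : Fin (k + 1) → ℕ} (hm : ∀ j, 1 ≤ m j) :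
    ∑ r ∈ Fintype.piFinset fun _ : Fin (k + 1) => Finset.Icc 1 (n + 1),
        (∏ j, (-1) ^ r j * (-(Complex.I * r j)) ^ m j) *
          ∑ c ∈ (Finset.range (n + 2)).filter (· ≤ ∑ j, r j), (-1) ^ (c + 1) * (c : ℂ) *
            ((k + 1 - if c = n + 1 then 1 else 0).choose (∑ j, r j - c) : ℂ) =
      -(-Complex.I) ^ (∑ j, m j) *
        ∑ c ∈ Finset.range (n + 1), altSum k (powerConvolution m) (c + 1) := by
  set S := powerConvolution m with hS
  have h1 : ∑ r ∈ Fintype.piFinset fun _ : Fin (k + 1) => Finset.Icc 1 (n + 1),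
        (∏ j, (-1) ^ r j * (-(Complex.I * r j)) ^ m j) *
          ∑ c ∈ (Finset.range (n + 2)).filter (· ≤ ∑ j, r j), (-1) ^ (c + 1) * (c : ℂ) *
            ((k + 1 - if c = n + 1 then 1 else 0).choose (∑ j, r j - c) : ℂ) =
      (-Complex.I) ^ (∑ j, m j) * ∑ c ∈ Finset.range (n + 2), (-1) ^ (c + 1) * (c : ℂ) *
        ∑ r ∈ (Fintype.piFinset fun _ : Fin (k + 1) => Finset.Icc 1 (n + 1)).filter (fun r => c ≤ ∑ j, r j),
        (-1) ^ (∑ j, r j) * (∏ j, (r j : ℂ) ^ m j) *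
          ((k + 1 - if c = n + 1 then 1 else 0).choose (∑ j, r j - c) : ℂ) := by
    simp only [Finset.sum_filter, Finset.mul_sum]
    rw [Finset.sum_comm]
    refine Finset.sum_congr rfl fun c _ => Finset.sum_congr rfl fun r _ => ?_
    split_ifs <;>
    simp only [neg_mul_eq_neg_mul, mul_pow, Finset.prod_mul_distrib, Finset.prod_pow_eq_pow_sum] <;>
    ring
  have h2 : ∀ c ∈ Finset.range (n + 1), (-1) ^ (c + 1) * (c : ℂ) *
        ∑ r ∈ (Fintype.piFinset fun _ : Fin (k + 1) => Finset.Icc 1 (n + 1)).filter (fun r => c ≤ ∑ j, r j),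
        (-1) ^ (∑ j, r j) * (∏ j, (r j : ℂ) ^ m j) *
          ((k + 1 - if c = n + 1 then 1 else 0).choose (∑ j, r j - c) : ℂ) =
      -((c : ℂ) * (altSum k S c - altSum k S (c + 1))) := by
    intro c hc
    have hc' := Finset.mem_range.1 hc
    rw [if_neg (by omega), sum_box_eq hm (by omega) (by omega), ← altSum_succ, altSum]
    simp only [Nat.sub_zero, Finset.mul_sum, ← Finset.sum_neg_distrib]
    refine Finset.sum_congr rfl fun a _ => ?_
    have : (-1 : ℂ) ^ c * (-1) ^ c = 1 := by rw [← mul_pow]; simp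
    rw [pow_add, pow_succ]
    linear_combination (-(c : ℂ) * (-1) ^ a * ((k + 1).choose a : ℂ) * S (c + a)) * this
  have h3 : (-1) ^ (n + 1 + 1) * ((n + 1 : ℕ) : ℂ) *
        ∑ r ∈ (Fintype.piFinset fun _ : Fin (k + 1) => Finset.Icc 1 (n + 1)).filter
          (fun r => n + 1 ≤ ∑ j, r j), (-1) ^ (∑ j, r j) * (∏ j, (r j : ℂ) ^ m j) *
          ((k + 1 - if n + 1 = n + 1 then 1 else 0).choose (∑ j, r j - (n + 1)) : ℂ) =
      -((n + 1 : ℂ) * altSum k S (n + 1)) := by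
    rw [if_pos rfl, sum_box_eq hm (by omega) (by omega), Finset.sum_range_succ, altSum]
    simp only [Nat.add_sub_cancel, Nat.choose_succ_self, Nat.cast_zero, mul_zero, zero_mul, add_zero,
      Finset.mul_sum, ← Finset.sum_neg_distrib]
    refine Finset.sum_congr rfl fun a _ => ?_
    have : (-1 : ℂ) ^ (n + 1) * (-1) ^ (n + 1) = 1 := by rw [← mul_pow]; simp
    rw [pow_add _ (n + 1) a, pow_succ _ (n + 1)]
    push_cast
    linear_combination (-((n : ℂ) + 1) * (-1) ^ a * (k.choose a : ℂ) * S (n + 1 + a)) * this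
  rw [h1, Finset.sum_range_succ, Finset.sum_congr rfl h2, h3, ← sum_range_mul_sub,
    Finset.sum_neg_distrib]
  ring

theorem sum_range_choose_succ (k q N : ℕ) :
    ∑ c ∈ Finset.range N, ((c + 1 + k).choose q : ℂ) =
      ((N + (k + 1)).choose (q + 1) : ℂ) - ((k + 1).choose (q + 1) : ℂ) := by
  induction N with
  | zero => simp
  | succ N ih =>
    rw [Finset.sum_range_succ, ih, show N + 1 + (k + 1) = N + (k + 1) + 1 by ring,
      Nat.choose_succ_succ' (N + (k + 1)) q, show N + 1 + k = N + (k + 1) by ring]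
    push_cast; ring

/-- The expectation as a combination of binomial coefficients in `N`. -/
theorem exists_expectation_eq_sum_choose {k : ℕ} {m : Fin (k + 1) → ℕ} (hm : ∀ j, 1 ≤ m j) :
    ∃ β : Fin (k + 1) → ℕ → ℂ, (∀ j, β j (m j) = (m j).factorial) ∧ ∀ N, 2 ≤ N →
      expectation N (fun U => mixedDerivAverage m U) = (1 / (N : ℂ)) *
        ((-1) ^ (k + 1) * (-Complex.I) ^ (∑ j, m j) *
          ∑ p ∈ Fintype.piFinset fun j => Finset.range (m j + 1), (∏ j, β j (p j)) *
            (((N + (k + 1)).choose (∑ j, p j + 1) : ℂ) - ((k + 1).choose (∑ j, p j + 1) : ℂ))) := by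
  choose β hβ hβ' using fun j => exists_pow_eq_sum_choose (m j)
  refine ⟨β, hβ, fun N hN => ?_⟩
  obtain ⟨n, rfl⟩ : ∃ n, N = n + 1 := ⟨N - 1, by omega⟩
  rw [expectation_mixedDerivAverage_eq (by omega) (by omega) hm, sum_expectation_eq hm]
  have hS : powerConvolution m = fun x => ∑ p ∈ Fintype.piFinset fun j => Finset.range (m j + 1),
      (∏ j, β j (p j)) * ((x + k).choose (∑ j, p j + k) : ℂ) := by
    funext x
    simp only [powerConvolution, hβ', Finset.prod_univ_sum]
    rw [Finset.sum_comm]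
    refine Finset.sum_congr rfl fun p _ => ?_
    simp only [Finset.prod_mul_distrib]
    rw [← Finset.mul_sum, sum_piAntidiag_prod_choose]
  have hshift : ∀ (f : ℕ → ℂ) (y : ℕ), altSum k (fun x => f (x + k)) y = altSum k f (y + k) := by
    intro f y
    refine Finset.sum_congr rfl fun a _ => ?_
    rw [add_right_comm]
  have hT : ∀ y, altSum k (powerConvolution m) y =
      ∑ p ∈ Fintype.piFinset fun j => Finset.range (m j + 1),
        (∏ j, β j (p j)) * ((-1) ^ k * ((y + k).choose (∑ j, p j) : ℂ)) := by
    intro y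
    rw [hS, altSum_sum]
    refine Finset.sum_congr rfl fun p _ => ?_
    rw [hshift (fun x => (x.choose (∑ j, p j + k) : ℂ)), altSum_choose]
  simp only [hT]
  rw [Finset.sum_comm]
  simp only [← Finset.mul_sum, sum_range_choose_succ]
  simp only [mul_left_comm _ ((-1 : ℂ) ^ k), ← Finset.mul_sum]
  ring

/-! ### Asymptotics. -/

theorem tendsto_choose_div_pow (k s : ℕ) :
    Tendsto (fun N : ℕ => ((N + k).choose s : ℂ) / (N : ℂ) ^ s) atTop (nhds (1 / s.factorial)) := by
  have h1 : Tendsto (fun N : ℕ => ((N + k).choose s : ℝ) / ((N + k : ℕ) : ℝ) ^ s) atTop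
      (nhds (1 / s.factorial)) := by
    have h2 : Tendsto (fun N : ℕ => (N.choose s : ℝ) / (N : ℝ) ^ s) atTop
        (nhds (1 / s.factorial)) := by
      have h3 := (isEquivalent_choose s).mul (IsEquivalent.refl (u := fun n : ℕ => ((n : ℝ) ^ s)⁻¹))
      have h4 : Tendsto ((fun n : ℕ => ((n : ℝ) ^ s / s.factorial)) * fun n : ℕ => ((n : ℝ) ^ s)⁻¹)
          atTop (nhds (1 / s.factorial)) := by
        refine tendsto_const_nhds.congr' ?_
        filter_upwards [eventually_ge_atTop 1] with n hn
        have : (n : ℝ) ^ s ≠ 0 := pow_ne_zero _ (by exact_mod_cast (by omega : n ≠ 0))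
        simp only [Pi.mul_apply]
        field_simp
      exact (h3.symm.tendsto_nhds h4)
    exact h2.comp (tendsto_add_atTop_nat k)
  have h5 : Tendsto (fun N : ℕ => (((N + k : ℕ) : ℝ) / (N : ℝ)) ^ s) atTop (nhds 1) := by
    have h6 : Tendsto (fun N : ℕ => ((N + k : ℕ) : ℝ) / (N : ℝ)) atTop (nhds 1) := by
      have h7 : Tendsto (fun N : ℕ => 1 + (k : ℝ) / (N : ℝ)) atTop (nhds (1 + 0)) :=
        tendsto_const_nhds.add (tendsto_const_div_atTop_nhds_zero_nat (k : ℝ))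
      rw [add_zero] at h7
      refine h7.congr' ?_
      filter_upwards [eventually_ge_atTop 1] with n hn
      have : (n : ℝ) ≠ 0 := by exact_mod_cast (by omega : n ≠ 0)
      push_cast
      field_simp
    simpa using h6.pow s
  have h8 := h1.mul h5
  rw [mul_one] at h8
  have h9 : Tendsto (fun N : ℕ => ((N + k).choose s : ℝ) / (N : ℝ) ^ s) atTop
      (nhds (1 / s.factorial)) := by
    refine h8.congr' ?_
    filter_upwards [eventually_ge_atTop 1] with n hn
    have h10 : (n : ℝ) ≠ 0 := by exact_mod_cast (by omega : n ≠ 0)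
    have h11 : ((n + k : ℕ) : ℝ) ≠ 0 := by exact_mod_cast (by omega : n + k ≠ 0)
    rw [div_pow]
    field_simp
  have h12 := (Complex.continuous_ofReal.tendsto _).comp h9
  refine (h12.congr fun N => ?_).trans_eq ?_
  · simp
  · simp

theorem tendsto_choose_sub_div_pow (k : ℕ) {q M : ℕ} (hq : q ≤ M) :
    Tendsto (fun N : ℕ => (((N + k).choose (q + 1) : ℂ) - (k.choose (q + 1) : ℂ)) / (N : ℂ) ^ (M + 1))
      atTop (nhds (if q = M then 1 / (M + 1).factorial else 0)) := by
  have h0 : ∀ a : ℕ, a ≠ 0 → Tendsto (fun N : ℕ => 1 / (N : ℂ) ^ a) atTop (nhds 0) := fun a ha => by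
    have := (tendsto_inv_atTop_nhds_zero_nat (𝕜 := ℂ)).pow a
    simpa [ha] using this
  have h1 : Tendsto (fun N : ℕ => (k.choose (q + 1) : ℂ) * (1 / (N : ℂ) ^ (M + 1))) atTop (nhds 0) := by
    simpa using (h0 (M + 1) M.succ_ne_zero).const_mul (k.choose (q + 1) : ℂ)
  have h2 : Tendsto (fun N : ℕ => ((N + k).choose (q + 1) : ℂ) / (N : ℂ) ^ (M + 1))
      atTop (nhds (if q = M then 1 / (M + 1).factorial else 0)) := by
    split_ifs with h
    · subst h
      exact tendsto_choose_div_pow k (q + 1)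
    · have h3 := (tendsto_choose_div_pow k (q + 1)).mul (h0 (M - q) (by omega))
      rw [mul_zero] at h3
      refine h3.congr fun N => ?_
      rw [div_mul_div_comm, mul_one, ← pow_add]
      congr 2
      omega
  have h4 := h2.sub h1
  rw [sub_zero] at h4
  exact h4.congr fun N => by ring

theorem tendsto_expectation_mixedDerivAverage_div_pow {k : ℕ} {m : Fin (k + 1) → ℕ}
    (hm : ∀ j, 1 ≤ m j) :
    Tendsto (fun N : ℕ => expectation N (fun U => mixedDerivAverage m U) / (N : ℂ) ^ (∑ j, m j))
      atTop (nhds ((-1) ^ (k + 1) * (-Complex.I) ^ (∑ j, m j) *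
        ((∏ j, ((m j).factorial : ℂ)) / ((∑ j, m j) + 1).factorial))) := by
  obtain ⟨β, hβ, hE⟩ := exists_expectation_eq_sum_choose hm
  set M := ∑ j, m j with hM
  have hsum : ∑ p ∈ Fintype.piFinset fun j => Finset.range (m j + 1), (∏ j, β j (p j)) *
      (if ∑ j, p j = M then 1 / ((M + 1).factorial : ℂ) else 0) =
      (∏ j, ((m j).factorial : ℂ)) / (M + 1).factorial := by
    -- Since `p j ≤ m j` for every `j`, the total `M` is attained only by `p = m`.
    rw [Finset.sum_eq_single m]
    · simp only [hβ, ← hM, if_true]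
      ring
    · intro p hp hpm
      rw [if_neg, mul_zero]
      intro h
      apply hpm
      funext j
      have hle : ∀ j ∈ Finset.univ, p j ≤ m j := fun j _ => by
        have := Finset.mem_range.1 (Fintype.mem_piFinset.1 hp j)
        omega
      exact (Finset.sum_eq_sum_iff_of_le hle).1 h j (Finset.mem_univ j)
    · intro h
      exact absurd (Fintype.mem_piFinset.2 fun j => Finset.mem_range.2 (Nat.lt_succ_self _)) h
  rw [← hsum]
  have hlim : Tendsto (fun N : ℕ => (-1) ^ (k + 1) * (-Complex.I) ^ M *
      ∑ p ∈ Fintype.piFinset fun j => Finset.range (m j + 1), (∏ j, β j (p j)) *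
        ((((N + (k + 1)).choose (∑ j, p j + 1) : ℂ) - ((k + 1).choose (∑ j, p j + 1) : ℂ)) /
          (N : ℂ) ^ (M + 1))) atTop (nhds ((-1) ^ (k + 1) * (-Complex.I) ^ M *
      ∑ p ∈ Fintype.piFinset fun j => Finset.range (m j + 1), (∏ j, β j (p j)) *
        (if ∑ j, p j = M then 1 / ((M + 1).factorial : ℂ) else 0))) := by
    refine (tendsto_finsetSum _ fun p hp => ?_).const_mul _
    refine (tendsto_choose_sub_div_pow (k + 1) (Finset.sum_le_sum fun j _ => ?_)).const_mul _
    have := Finset.mem_range.1 (Fintype.mem_piFinset.1 hp j)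
    omega
  refine hlim.congr' ?_
  filter_upwards [eventually_ge_atTop 2] with N hN
  rw [hE N hN]
  simp only [← mul_div_assoc, ← Finset.sum_div]
  rw [one_div, inv_mul_eq_div, div_div, pow_succ' (N : ℂ) M]

theorem expectation_mixedDerivAverage_zero {N : ℕ} (hN : 1 ≤ N) (m : Fin 0 → ℕ) :
    expectation N (fun U => mixedDerivAverage m U) = 1 := by
  have hN' : (N : ℂ) ≠ 0 := by exact_mod_cast (by omega : N ≠ 0)
  have h : ∀ U : Matrix.unitaryGroup (Fin N) ℂ, mixedDerivAverage m U = 1 := by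
    intro U
    have hcard : (U : Matrix (Fin N) (Fin N) ℂ).charpoly.roots.card = N := by
      rw [Polynomial.splits_iff_card_roots.1 (IsAlgClosed.splits _),
        Matrix.charpoly_natDegree_eq_dim, Fintype.card_fin]
    simp [mixedDerivAverage, eigenangles, hcard, hN']
  simp only [expectation, h]
  simp

end RandomUnitary

theorem theorem4 (k : ℕ) (n : Fin k → ℕ) (hn : ∀ j, 1 ≤ n j) :
    (fun N : ℕ => RandomUnitary.expectation N
        (fun U => RandomUnitary.mixedDerivAverage n U))
      ~[atTop]
    (fun N : ℕ => (-1 : ℂ) ^ ((∑ j, (n j : ℤ)) - (k : ℤ)) * Complex.I ^ (∑ j, n j) *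
        ((∏ j, ((n j).factorial : ℂ)) / (((∑ j, n j) + 1).factorial : ℂ)) *
        (N : ℂ) ^ (∑ j, n j)) := by
  rcases k with _ | k
  · refine EventuallyEq.isEquivalent ?_
    -- With no factors both sides equal `1`; `N = 0` is left out because the average is then `0` by
    -- the convention `1 / 0 = 0`.
    filter_upwards [eventually_ge_atTop 1] with N hN
    rw [RandomUnitary.expectation_mixedDerivAverage_zero hN]
    simp
  · set M := ∑ j, n j with hM
    -- `(-1)^M` turns `I^M` into `(-I)^M`, and `(-1)^(-(k+1)) = (-1)^(k+1)`.
    have hsign : (-1 : ℂ) ^ ((∑ j, (n j : ℤ)) - ((k + 1 : ℕ) : ℤ)) * Complex.I ^ M =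
        (-1) ^ (k + 1) * (-Complex.I) ^ M := by
      rw [← Nat.cast_sum, ← hM, zpow_sub₀ (by norm_num), zpow_natCast, zpow_natCast, neg_pow Complex.I,
        div_eq_mul_inv, ← inv_pow]
      norm_num
      ring
    have hL : (-1 : ℂ) ^ (k + 1) * (-Complex.I) ^ M *
        ((∏ j, ((n j).factorial : ℂ)) / ((M + 1).factorial : ℂ)) ≠ 0 := by
      refine mul_ne_zero (mul_ne_zero (by simp) (by simp)) (div_ne_zero ?_ ?_)
      · exact Finset.prod_ne_zero_iff.2 fun j _ => by exact_mod_cast (n j).factorial_ne_zero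
      · exact_mod_cast (M + 1).factorial_ne_zero
    rw [hsign]
    have h := (isEquivalent_const_iff_tendsto hL).2
      (RandomUnitary.tendsto_expectation_mixedDerivAverage_div_pow hn)
    refine (h.mul (IsEquivalent.refl (u := fun N : ℕ => (N : ℂ) ^ M))).congr_left ?_
    filter_upwards [eventually_ge_atTop 1] with N hN
    have hN' : (N : ℂ) ≠ 0 := by exact_mod_cast (by omega : N ≠ 0)
    exact div_mul_cancel₀ _ (pow_ne_zero _ hN')
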